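/- Let $p$ be a prime and let $R$ be a noetherian commutative $\mathbb{F}_p$-algebra which is $F$-finite, i.e. whose Frobenius $F : R \to R$, $r \mapsto r^p$, is a finite ring homomorphism. Let $\operatorname{QCoh}_\kappa(R)$ be the category of Cartier modules, i.e. of right modules over the noncommutative ring $R[F] = R\{F\}/\langle r^pF - Fr \mid r \in R\rangle$; equivalently, $R$-modules $M$ with an $R$-linear map $C_M : F_*M \to M$ (the right action of $F$), or with its adjoint $\kappa_M : M \to F^\flat M := \operatorname{Hom}_R(F_*R, M)$. A Cartier module is nilpotent if some power of $F$ acts as zero on it, and locally nilpotent if it is the union of its nilpotent Cartier submodules. The locally nilpotent Cartier modules form a Serre subcategory $\operatorname{LNil}_\kappa(R)$; let $\operatorname{QCrys}_\kappa(R) = \operatorname{QCoh}_\kappa(R)/\operatorname{LNil}_\kappa(R)$ be the quotient category and $\pi : \operatorname{QCoh}_\kappa(R) \to \operatorname{QCrys}_\kappa(R)$ the localization functor. For a Cartier module $M$, $F^\flat M$ is a Cartier module with adjoint structural map $F^\flat(\kappa_M)$, so that $\kappa_M$ is a map of Cartier modules; let $u(M) = \operatorname{colim}_e F^{e\flat}M$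 be the colimit in $\operatorname{QCoh}_\kappa(R)$ of $M \xrightarrow{\kappa_M} F^\flat M \xrightarrow{F^\flat\kappa_M} F^{2\flat} M \to \cdots$, and let $\eta : \operatorname{id} \to u$ be the natural map into the colimit. (1) The functor $\pi$ is exact and has a right adjoint $\overline{u} : \operatorname{QCrys}_\kappa(R) \to \operatorname{QCoh}_\kappa(R)$. For every right adjoint $\overline{u}$ of $\pi$, the counit $\pi \circ \overline{u} \to \operatorname{id}$ is an isomorphism (equivalently, $\overline{u}$ is fully faithful). (2) If $I \in \operatorname{QCrys}_\kappa(R)$ is injective, then $\overline{u}(I)$ is injective in $\operatorname{QCoh}_\kappa(R)$. (3) If $R$ is moreover regular, then $\overline{u}$ is exact; there is a natural isomorphism $u \cong \overline{u} \circ \pi$ which carries $\eta$ to the unit $\operatorname{id} \to \overline{u} \circ \pi$ of the adjunction; and for $I \in \operatorname{QCrys}_\kappa(R)$, if $\overline{u}(I)$ is injective in $\operatorname{QCoh}_\kappa(R)$, then $I$ is injective. -/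

import Mathlib

open CategoryTheory Limits MulOpposite

universe u

noncomputable section

namespace Cartier

section FrobeniusRing

variable (p : ℕ) [Fact p.Prime] (R : Type u) [CommRing R] [Algebra (ZMod p) R]

/-- The absolute Frobenius `r ↦ r ^ p` of an `𝔽_p`-algebra (the zero ring is allowed). -/
def frob : R →+* R where
  toFun r := r ^ p
  map_one' := one_pow p
  map_mul' a b := mul_pow a b p
  map_zero' := zero_pow (Fact.out : p.Prime).ne_zero
  map_add' a b := by
    rcases subsingleton_or_nontrivial R with h | h
    · exact Subsingleton.elim _ _
    · have : CharP R p := charP_of_injective_algebraMap (algebraMap (ZMod p) R).injective p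
      exact add_pow_char a b p

@[simp]
lemma frob_apply (r : R) : frob p R r = r ^ p := rfl

/-- `R` is `F`-finite: its Frobenius endomorphism is a finite map of rings. -/
class FFinite : Prop where
  finite_frob : (frob p R).Finite

/-- The defining relations of `R[F]` on the free ring on the set `R ⊔ {F}`, where `some r` stands
for `r` and `none` for `F`. The first three say that `R → R{F}` is a ring homomorphism, so that
they cut out `R{F}`; the last one is `r ^ p F = F r`. -/
inductive SkewRel : FreeAlgebra ℤ (Option R) → FreeAlgebra ℤ (Option R) → Prop
  | add (r s : R) : SkewRel (FreeAlgebra.ι ℤ (some (r + s)))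
      (FreeAlgebra.ι ℤ (some r) + FreeAlgebra.ι ℤ (some s))
  | mul (r s : R) : SkewRel (FreeAlgebra.ι ℤ (some (r * s)))
      (FreeAlgebra.ι ℤ (some r) * FreeAlgebra.ι ℤ (some s))
  | one : SkewRel (FreeAlgebra.ι ℤ (some 1)) 1
  | frob (r : R) : SkewRel (FreeAlgebra.ι ℤ (some (frob p R r)) * FreeAlgebra.ι ℤ none)
      (FreeAlgebra.ι ℤ none * FreeAlgebra.ι ℤ (some r))

/-- The noncommutative ring `R[F] = R{F} / ⟨r ^ p F - F r⟩`. -/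
abbrev FrobRing : Type u := RingQuot (SkewRel p R)

/-- The canonical ring homomorphism `R → R[F]`. -/
def coeff : R →+* FrobRing p R where
  toFun r := RingQuot.mkRingHom (SkewRel p R) (FreeAlgebra.ι ℤ (some r))
  map_one' := by rw [RingQuot.mkRingHom_rel SkewRel.one, map_one]
  map_mul' r s := by rw [RingQuot.mkRingHom_rel (SkewRel.mul r s), map_mul]
  map_add' r s := by rw [RingQuot.mkRingHom_rel (SkewRel.add r s), map_add]
  map_zero' := by
    have h := RingQuot.mkRingHom_rel (SkewRel.add (p := p) (0 : R) 0)
    rw [map_add, add_zero] at h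
    simpa using h

/-- The element `F` of `R[F]`. -/
def F : FrobRing p R := RingQuot.mkRingHom (SkewRel p R) (FreeAlgebra.ι ℤ none)

lemma coeff_frob_mul_F (r : R) : coeff p R (frob p R r) * F p R = F p R * coeff p R r := by
  have h := RingQuot.mkRingHom_rel (SkewRel.frob (p := p) r)
  rw [map_mul, map_mul] at h
  exact h

variable {p R} in
@[elab_as_elim]
lemma FrobRing.induction {P : FrobRing p R → Prop} (hR : ∀ r, P (coeff p R r)) (hF : P (F p R))
    (hadd : ∀ x y, P x → P y → P (x + y)) (hmul : ∀ x y, P x → P y → P (x * y))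
    (x : FrobRing p R) : P x := by
  obtain ⟨a, rfl⟩ := RingQuot.mkRingHom_surjective (SkewRel p R) x
  induction a using FreeAlgebra.induction with
  | grade0 n =>
    have : RingQuot.mkRingHom (SkewRel p R) (algebraMap ℤ _ n) = coeff p R n := by simp
    rw [this]
    exact hR _
  | grade1 o =>
    cases o with
    | none => exact hF
    | some r => exact hR r
  | mul a b ha hb => rw [map_mul]; exact hmul _ _ ha hb
  | add a b ha hb => rw [map_add]; exact hadd _ _ ha hb

variable {p R} in
/-- The universal property of `R[F]`. -/
def FrobRing.lift {T : Type*} [Ring T] (f : R →+* T) (t : T)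
    (h : ∀ r, f (frob p R r) * t = t * f r) : FrobRing p R →+* T :=
  RingQuot.lift ⟨(FreeAlgebra.lift ℤ (fun o : Option R ↦ o.elim t f)).toRingHom, by
    rintro _ _ (⟨r, s⟩ | ⟨r, s⟩ | _ | r)
    · simp
    · simp
    · simp
    · simpa using h r⟩

variable {p R} in
@[simp]
lemma FrobRing.lift_coeff {T : Type*} [Ring T] (f : R →+* T) (t : T)
    (h : ∀ r, f (frob p R r) * t = t * f r) (r : R) :
    FrobRing.lift f t h (coeff p R r) = f r := by
  simp [FrobRing.lift, coeff]

variable {p R} in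
@[simp]
lemma FrobRing.lift_F {T : Type*} [Ring T] (f : R →+* T) (t : T)
    (h : ∀ r, f (frob p R r) * t = t * f r) : FrobRing.lift f t h (F p R) = t := by
  simp [FrobRing.lift, F]

end FrobeniusRing

section Modules

variable (p : ℕ) [Fact p.Prime] (R : Type u) [CommRing R] [Algebra (ZMod p) R]

/-- The category `QCoh_κ(R)` of Cartier modules: right `R[F]`-modules. -/
abbrev QCoh : Type (u + 1) := ModuleCat.{u} (FrobRing p R)ᵐᵒᵖ

/-- The map `R → R[F]ᵒᵖ`; it is a ring homomorphism as `R` is commutative. -/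
def coeffOp : R →+* (FrobRing p R)ᵐᵒᵖ :=
  (coeff p R).toOpposite fun r s ↦ by
    rw [commute_iff_eq, ← map_mul, ← map_mul, mul_comm]

@[simp]
lemma coeffOp_apply (r : R) : coeffOp p R r = op (coeff p R r) := rfl

/-- The functor sending a Cartier module to the underlying `R`-module. -/
abbrev underlying : QCoh p R ⥤ ModuleCat.{u} R := ModuleCat.restrictScalars (coeffOp p R)

/-- `F_*` on `R`-modules: restriction of scalars along the Frobenius. -/
abbrev frobPush : ModuleCat.{u} R ⥤ ModuleCat.{u} R := ModuleCat.restrictScalars (frob p R)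

/-- `F^♭ = Hom_R(F_* R, -)` on `R`-modules, with `r • φ = (s ↦ φ (s * r))`. -/
abbrev frobFlat : ModuleCat.{u} R ⥤ ModuleCat.{u} R := ModuleCat.coextendScalars (frob p R)

/-- The adjunction `F_* ⊣ F^♭` on `R`-modules. -/
abbrev frobAdj : frobPush p R ⊣ frobFlat p R := ModuleCat.restrictCoextendScalarsAdj (frob p R)

variable {p R}

/-- The structural map `C_M : F_* M ⟶ M` of a Cartier module, given by the right action of `F`. -/
def structMap (M : QCoh p R) :
    (frobPush p R).obj ((underlying p R).obj M) ⟶ (underlying p R).obj M :=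
  ModuleCat.ofHom (X := (frobPush p R).obj ((underlying p R).obj M))
    (Y := (underlying p R).obj M)
    { toFun := fun m ↦ (op (F p R) • (show M from m) : M)
      map_add' := fun m n ↦ smul_add (op (F p R)) (show M from m) (show M from n)
      map_smul' := fun r m ↦ by
        change (op (F p R) • op (coeff p R (frob p R r)) • (show M from m) : M) =
          op (coeff p R r) • op (F p R) • (show M from m)
        rw [← mul_smul, ← mul_smul, ← op_mul, ← op_mul, coeff_frob_mul_F] }

@[simp]
lemma structMap_apply (M : QCoh p R) (m : M) :
    (structMap M).hom m = (op (F p R) • m : M) := rfl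

/-- The adjoint structural map `κ_M : M ⟶ F^♭ M`. -/
def adjStructMap (M : QCoh p R) :
    (underlying p R).obj M ⟶ (frobFlat p R).obj ((underlying p R).obj M) :=
  (frobAdj p R).homEquiv _ _ (structMap M)

/-- `κ_M (m) (s) = (m s) F`. -/
lemma adjStructMap_apply (M : QCoh p R) (m : M) (s : R) :
    (adjStructMap M).hom m s = (op (F p R) • op (coeff p R s) • m : M) := rfl

/-- The right action of `R[F]` on an `R`-module `N` with a map `C : F_* N ⟶ N`, as a ring
homomorphism; `r` acts by multiplication and `F` acts by `C`. -/
def actionHom (N : ModuleCat.{u} R) (C : (frobPush p R).obj N ⟶ N) :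
    (FrobRing p R)ᵐᵒᵖ →+* AddMonoid.End N :=
  ((RingEquiv.opOp (AddMonoid.End N)).symm : (AddMonoid.End N)ᵐᵒᵖᵐᵒᵖ →+* AddMonoid.End N).comp
  (RingHom.op (FrobRing.lift (T := (AddMonoid.End N)ᵐᵒᵖ)
    ((Module.toAddMonoidEnd R N).toOpposite fun r s ↦ by
      rw [commute_iff_eq, ← map_mul, ← map_mul, mul_comm])
    (op (C.hom.toAddMonoidHom : N →+ N)) fun r ↦ by
      apply unop_injective
      ext n
      exact C.hom.map_smul r n))

/-- The Cartier module given by an `R`-module `N` together with a structural map `F_* N ⟶ N`. -/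
def ofStruct (N : ModuleCat.{u} R) (C : (frobPush p R).obj N ⟶ N) : QCoh p R :=
  letI : Module (FrobRing p R)ᵐᵒᵖ N := Module.compHom N (actionHom N C)
  ModuleCat.of (FrobRing p R)ᵐᵒᵖ N

lemma ofStruct_coeff_smul (N : ModuleCat.{u} R) (C : (frobPush p R).obj N ⟶ N) (r : R) (n : N) :
    (op (coeff p R r) • (show ofStruct N C from n) : ofStruct N C) = (r • n : N) := by
  change (actionHom N C (op (coeff p R r)) : N →+ N) n = r • n
  simp [actionHom]
  rfl

lemma ofStruct_F_smul (N : ModuleCat.{u} R) (C : (frobPush p R).obj N ⟶ N) (n : N) :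
    (op (F p R) • (show ofStruct N C from n) : ofStruct N C) = (C.hom n : N) := by
  change (actionHom N C (op (F p R)) : N →+ N) n = C.hom n
  simp [actionHom]
  rfl

/-- The underlying `R`-module of `ofStruct N C` is `N`. -/
def underlyingOfStruct (N : ModuleCat.{u} R) (C : (frobPush p R).obj N ⟶ N) :
    (underlying p R).obj (ofStruct N C) ≅ N where
  hom := ModuleCat.ofHom (X := (underlying p R).obj (ofStruct N C)) (Y := N)
    { toFun := fun n ↦ (n : N)
      map_add' := fun _ _ ↦ rfl
      map_smul' := fun r n ↦ ofStruct_coeff_smul N C r n }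
  inv := ModuleCat.ofHom (X := N) (Y := (underlying p R).obj (ofStruct N C))
    { toFun := fun n ↦ (n : N)
      map_add' := fun _ _ ↦ rfl
      map_smul' := fun r n ↦ (ofStruct_coeff_smul N C r n).symm }
  hom_inv_id := by ext; rfl
  inv_hom_id := by ext; rfl

/-- The structural map of `ofStruct N C` is `C`. -/
lemma structMap_ofStruct (N : ModuleCat.{u} R) (C : (frobPush p R).obj N ⟶ N) :
    structMap (ofStruct N C) ≫ (underlyingOfStruct N C).hom =
      (frobPush p R).map (underlyingOfStruct N C).hom ≫ C := by
  ext n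
  exact ofStruct_F_smul N C n

lemma map_smul_of_generators {M N : QCoh p R} (f : M →+ N)
    (hR : ∀ (r : R) (m : M), f (op (coeff p R r) • m) = op (coeff p R r) • f m)
    (hF : ∀ m : M, f (op (F p R) • m) = op (F p R) • f m) (x : (FrobRing p R)ᵐᵒᵖ) (m : M) :
    f (x • m) = x • f m := by
  induction x using MulOpposite.rec' with
  | h x =>
    induction x using FrobRing.induction generalizing m with
    | hR r => exact hR r m
    | hF => exact hF m
    | hadd x y hx hy => rw [MulOpposite.op_add, add_smul, add_smul, map_add, hx, hy]
    | hmul x y hx hy => rw [op_mul, mul_smul, mul_smul, hy, hx]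

/-- An `R`-linear map between Cartier modules which commutes with the structural maps is
a morphism of Cartier modules. -/
def homMk {M N : QCoh p R} (f : (underlying p R).obj M ⟶ (underlying p R).obj N)
    (h : structMap M ≫ f = (frobPush p R).map f ≫ structMap N) : M ⟶ N :=
  ModuleCat.ofHom
    { toFun := fun m ↦ (f.hom m : N)
      map_add' := fun m n ↦ f.hom.map_add m n
      map_smul' := map_smul_of_generators (f.hom.toAddMonoidHom : M →+ N)
        (fun r m ↦ f.hom.map_smul r m) (fun m ↦ congrArg (fun g ↦ (g.hom m : N)) h) }

@[simp]
lemma homMk_apply {M N : QCoh p R} (f : (underlying p R).obj M ⟶ (underlying p R).obj N)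
    (h : structMap M ≫ f = (frobPush p R).map f ≫ structMap N) (m : M) :
    (homMk f h).hom m = (f.hom m : N) := rfl

lemma structMap_naturality {M N : QCoh p R} (f : M ⟶ N) :
    structMap M ≫ (underlying p R).map f =
      (frobPush p R).map ((underlying p R).map f) ≫ structMap N := by
  ext m
  exact f.hom.map_smul (op (F p R)) m

lemma adjStructMap_naturality {M N : QCoh p R} (f : M ⟶ N) :
    adjStructMap M ≫ (frobFlat p R).map ((underlying p R).map f) =
      (underlying p R).map f ≫ adjStructMap N := by
  rw [adjStructMap, adjStructMap, ← Adjunction.homEquiv_naturality_right,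
    ← Adjunction.homEquiv_naturality_left, structMap_naturality]

/-- The structural map of `F^♭ M`: the map `F_* F^♭ M ⟶ F^♭ M` whose adjoint is
`F^♭ (κ_M) : F^♭ M ⟶ F^♭ F^♭ M`. -/
def flatStruct (M : QCoh p R) :
    (frobPush p R).obj ((frobFlat p R).obj ((underlying p R).obj M)) ⟶
      (frobFlat p R).obj ((underlying p R).obj M) :=
  ((frobAdj p R).homEquiv _ _).symm ((frobFlat p R).map (adjStructMap M))

/-- The Cartier module `F^♭ M`. -/
abbrev flatObj (M : QCoh p R) : QCoh p R :=
  ofStruct ((frobFlat p R).obj ((underlying p R).obj M)) (flatStruct M)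

/-- An `R`-linear map from a Cartier module `M` to an `R`-module `N` with a structural map `C`,
commuting with the structural maps, as a morphism of Cartier modules. -/
def homToOfStruct {M : QCoh p R} {N : ModuleCat.{u} R} {C : (frobPush p R).obj N ⟶ N}
    (f : (underlying p R).obj M ⟶ N) (h : structMap M ≫ f = (frobPush p R).map f ≫ C) :
    M ⟶ ofStruct N C :=
  homMk (f ≫ (underlyingOfStruct N C).inv) (by
    rw [← cancel_mono (underlyingOfStruct N C).hom]
    simp only [Category.assoc, Iso.inv_hom_id, Category.comp_id]
    rw [structMap_ofStruct, h, ← Functor.map_comp_assoc]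
    simp)

lemma structMap_comp_flat {M N : QCoh p R} (f : M ⟶ N) :
    flatStruct M ≫ (frobFlat p R).map ((underlying p R).map f) =
      (frobPush p R).map ((frobFlat p R).map ((underlying p R).map f)) ≫ flatStruct N := by
  apply ((frobAdj p R).homEquiv _ _).injective
  rw [Adjunction.homEquiv_naturality_right, Adjunction.homEquiv_naturality_left,
    flatStruct, flatStruct, Equiv.apply_symm_apply, Equiv.apply_symm_apply,
    ← Functor.map_comp, ← Functor.map_comp, adjStructMap_naturality]

lemma structMap_comp_adjStructMap (M : QCoh p R) :
    structMap M ≫ adjStructMap M = (frobPush p R).map (adjStructMap M) ≫ flatStruct M := by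
  apply ((frobAdj p R).homEquiv _ _).injective
  rw [Adjunction.homEquiv_naturality_right, Adjunction.homEquiv_naturality_left,
    flatStruct, Equiv.apply_symm_apply]
  rfl

variable (p R) in
/-- The functor `F^♭ : QCoh_κ(R) ⥤ QCoh_κ(R)`, `f ↦ Hom_R(F_* R, f)`. -/
def flat : QCoh p R ⥤ QCoh p R where
  obj := flatObj
  map {M N} f := homToOfStruct
    ((underlyingOfStruct _ (flatStruct M)).hom ≫ (frobFlat p R).map ((underlying p R).map f)) (by
      rw [reassoc_of% (structMap_ofStruct _ (flatStruct M)), structMap_comp_flat,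
        Functor.map_comp_assoc])
  map_id M := by
    ext m
    rfl
  map_comp f g := by
    ext m
    rfl

variable (p R) in
/-- The maps `κ_M : M ⟶ F^♭ M`, as a natural transformation of functors on Cartier modules. -/
def kappa : 𝟭 (QCoh p R) ⟶ flat p R where
  app M := homToOfStruct (adjStructMap M) (structMap_comp_adjStructMap M)
  naturality M N f := by
    ext m
    exact congrArg (fun g ↦ g.hom m) (adjStructMap_naturality f).symm

variable (p R) in
/-- The iterates `F^{e♭}` of `F^♭`. -/
def flatPow : ℕ → (QCoh p R ⥤ QCoh p R)
  | 0 => 𝟭 _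
  | e + 1 => flat p R ⋙ flatPow e

variable (p R) in
/-- The maps `F^{e♭}(κ_M) : F^{e♭} M ⟶ F^{(e + 1)♭} M`. -/
def flatPowKappa (e : ℕ) : flatPow p R e ⟶ flatPow p R (e + 1) :=
  (flatPow p R e).leftUnitor.inv ≫ Functor.whiskerRight (kappa p R) (flatPow p R e)

variable (p R) in
/-- The directed system `M ⟶ F^♭ M ⟶ F^{2♭} M ⟶ ⋯`, functorially in `M`. -/
def unitalizationSystem : ℕ ⥤ (QCoh p R ⥤ QCoh p R) :=
  Functor.ofSequence (flatPowKappa p R)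

variable (p R) in
/-- Unitalization `u = colim_e F^{e♭}` (colimits of functors are computed objectwise). -/
def unitalization : QCoh p R ⥤ QCoh p R :=
  colimit (unitalizationSystem p R)

variable (p R) in
/-- The natural map `η : M ⟶ u(M)` into the colimit. -/
def eta : 𝟭 (QCoh p R) ⟶ unitalization p R :=
  colimit.ι (unitalizationSystem p R) 0

/-- A Cartier module is nilpotent if some power of `F` acts as zero on it. -/
def IsNilpotentModule (M : QCoh p R) : Prop :=
  ∃ n : ℕ, ∀ m : M, (op (F p R ^ n) • m : M) = 0

variable (p R) in
/-- The class `LNil_κ(R)` of locally nilpotent Cartier modules: those which are the union of their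
nilpotent Cartier submodules. -/
def LNil : ObjectProperty (QCoh p R) := fun M ↦
  ∀ m : M, ∃ N : Submodule (FrobRing p R)ᵐᵒᵖ M,
    IsNilpotentModule (ModuleCat.of (FrobRing p R)ᵐᵒᵖ N) ∧ m ∈ N

lemma op_F_smul_op_coeff_smul (M : QCoh p R) (r : R) (m : M) :
    (op (F p R) • op (coeff p R (frob p R r)) • m : M) = op (coeff p R r) • op (F p R) • m := by
  rw [← mul_smul, ← mul_smul, ← op_mul, ← op_mul, coeff_frob_mul_F]

lemma op_F_pow_smul_op_coeff_smul (M : QCoh p R) (n : ℕ) (r : R) (m : M) :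
    (op (F p R ^ n) • op (coeff p R ((frob p R ^ n) r)) • m : M) =
      op (coeff p R r) • op (F p R ^ n) • m := by
  induction n generalizing m with
  | zero => simp
  | succ n ih =>
    have h (x : M) : (op (F p R ^ (n + 1)) • x : M) = op (F p R ^ n) • op (F p R) • x := by
      rw [← mul_smul, ← op_mul, pow_succ']
    rw [h, h, pow_succ' (frob p R), ← ih, ← op_F_smul_op_coeff_smul]
    rfl

/-- The largest Cartier submodule of `M` on which `F ^ n` acts as zero. -/
def nilSubmodule (M : QCoh p R) (n : ℕ) : Submodule (FrobRing p R)ᵐᵒᵖ M where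
  carrier := {m | ∀ r : R, (op (F p R ^ n) • op (coeff p R r) • m : M) = 0}
  add_mem' {a b} ha hb r := by rw [smul_add, smul_add, ha r, hb r, add_zero]
  zero_mem' r := by rw [smul_zero, smul_zero]
  smul_mem' x m hm := by
    induction x using MulOpposite.rec' with
    | h x =>
      induction x using FrobRing.induction generalizing m with
      | hR s =>
        intro r
        rw [← mul_smul (op (coeff p R r)), ← op_mul, ← map_mul]
        exact hm _
      | hF =>
        intro r
        rw [← op_F_smul_op_coeff_smul, ← mul_smul, ← op_mul, ← pow_succ', pow_succ, op_mul,
          mul_smul, hm, smul_zero]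
      | hadd x y hx hy =>
        intro r
        rw [MulOpposite.op_add, add_smul, smul_add, smul_add, hx m hm r, hy m hm r, add_zero]
      | hmul x y hx hy =>
        rw [op_mul, mul_smul]
        exact hy _ (hx _ hm)

lemma mem_nilSubmodule_iff (M : QCoh p R) (n : ℕ) (m : M) :
    m ∈ nilSubmodule M n ↔ ∀ r : R, (op (F p R ^ n) • op (coeff p R r) • m : M) = 0 := Iff.rfl

lemma nilSubmodule_mono (M : QCoh p R) : Monotone (nilSubmodule M) := by
  intro a b hab m hm r
  obtain ⟨c, rfl⟩ := Nat.exists_eq_add_of_le hab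
  rw [pow_add, op_mul, mul_smul, hm r, smul_zero]

lemma LNil_iff (M : QCoh p R) : LNil p R M ↔ ∀ m : M, ∃ n, m ∈ nilSubmodule M n := by
  refine ⟨fun h m ↦ ?_, fun h m ↦ ?_⟩
  · obtain ⟨N, ⟨n, hn⟩, hm⟩ := h m
    exact ⟨n, fun r ↦ congrArg Subtype.val (hn ⟨_, N.smul_mem (op (coeff p R r)) hm⟩)⟩
  · obtain ⟨n, hn⟩ := h m
    refine ⟨nilSubmodule M n, ⟨n, fun x ↦ Subtype.ext ?_⟩, hn⟩
    have hx := x.2 1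
    rw [map_one, op_one, one_smul] at hx
    exact hx

lemma mem_nilSubmodule_map {M N : QCoh p R} (f : M ⟶ N) {n : ℕ} {m : M}
    (hm : m ∈ nilSubmodule M n) : f.hom m ∈ nilSubmodule N n := fun r ↦ by
  rw [← map_smul, ← map_smul, hm r, map_zero]

lemma finite_frob_pow [FFinite p R] (n : ℕ) : (frob p R ^ n).Finite := by
  induction n with
  | zero => exact RingHom.Finite.id R
  | succ n ih =>
    rw [pow_succ]
    exact ih.comp FFinite.finite_frob

lemma exists_generators {A B : Type*} [CommRing A] [CommRing B] {f : A →+* B} (hf : f.Finite) :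
    ∃ T : Finset B, ∀ P : B → Prop, (∀ t ∈ T, P t) → P 0 → (∀ x y, P x → P y → P (x + y)) →
      (∀ s x, P x → P (x * f s)) → ∀ b, P b := by
  let := f.toAlgebra
  obtain ⟨T, hT⟩ := hf.1
  refine ⟨T, fun P h₁ h₂ h₃ h₄ b ↦ ?_⟩
  have hb : b ∈ Submodule.span A (T : Set B) := by
    rw [hT]
    trivial
  induction hb using Submodule.span_induction with
  | mem t ht => exact h₁ t ht
  | zero => exact h₂
  | add x y _ _ hx hy => exact h₃ x y hx hy
  | smul s x _ hx =>
    rw [Algebra.smul_def, mul_comm]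
    exact h₄ s x hx

/-- For `F`-finite `R`, locally nilpotent Cartier modules form a Serre subcategory. -/
instance isSerreClass_LNil [FFinite p R] : (LNil p R).IsSerreClass where
  exists_zero := ⟨ModuleCat.of _ PUnit, ModuleCat.isZero_of_subsingleton _,
    fun m ↦ ⟨⊤, ⟨0, fun x ↦ rfl⟩, trivial⟩⟩
  prop_of_mono {X Y} f _ hY := by
    rw [LNil_iff] at hY ⊢
    intro m
    obtain ⟨n, hn⟩ := hY (f.hom m)
    refine ⟨n, fun r ↦ (ModuleCat.mono_iff_injective f).1 inferInstance ?_⟩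
    have := hn r
    rw [← map_smul, ← map_smul] at this
    exact this.trans (map_zero f.hom).symm
  prop_of_epi {X Y} f _ hX := by
    rw [LNil_iff] at hX ⊢
    intro m
    obtain ⟨m, rfl⟩ := (ModuleCat.epi_iff_surjective f).1 inferInstance m
    obtain ⟨n, hn⟩ := hX m
    exact ⟨n, mem_nilSubmodule_map f hn⟩
  prop_X₂_of_shortExact {S} hS h₁ h₃ := by
    rw [LNil_iff] at h₁ h₃ ⊢
    intro b
    obtain ⟨n, hn⟩ := h₃ (S.g.hom b)
    have hlift (r : R) : ∃ k, op (F p R ^ n) • op (coeff p R r) • b ∈ nilSubmodule S.X₂ k := by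
      have hr := hn r
      rw [← map_smul, ← map_smul] at hr
      obtain ⟨a, ha⟩ := (ShortComplex.moduleCat_exact_iff S).1 hS.exact _ hr
      obtain ⟨k, hk⟩ := h₁ a
      refine ⟨k, ?_⟩
      rw [← ha]
      exact mem_nilSubmodule_map S.f hk
    choose k hk using hlift
    obtain ⟨T, hT⟩ := exists_generators (finite_frob_pow (p := p) (R := R) n)
    have key (r : R) : op (F p R ^ n) • op (coeff p R r) • b ∈ nilSubmodule S.X₂ (T.sup k) := by
      refine hT (fun r ↦ op (F p R ^ n) • op (coeff p R r) • b ∈ nilSubmodule S.X₂ (T.sup k))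
        (fun t ht ↦ nilSubmodule_mono _ (Finset.le_sup ht) (hk t)) (by simp)
        (fun x y hx hy ↦ ?_) (fun s x hx ↦ ?_) r
      · rw [map_add, MulOpposite.op_add, add_smul, smul_add]
        exact add_mem hx hy
      · rw [map_mul, op_mul, mul_smul, op_F_pow_smul_op_coeff_smul]
        exact Submodule.smul_mem _ _ hx
    refine ⟨n + T.sup k, fun r ↦ ?_⟩
    have := key r 1
    rw [map_one, op_one, one_smul] at this
    rw [pow_add, op_mul, mul_smul, this]

variable (p R)
variable [FFinite p R]

/-- The category of quasi-coherent Cartier crystals `QCrys_κ(R) = QCoh_κ(R) / LNil_κ(R)`: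
the localization at the morphisms with locally nilpotent kernel and cokernel. -/
abbrev QCrys : Type (u + 1) := (LNil p R).isoModSerre.Localization

/-- The localization functor `π : QCoh_κ(R) ⥤ QCrys_κ(R)`. -/
abbrev toCrys : QCoh p R ⥤ QCrys p R := (LNil p R).isoModSerre.Q

/-- `QCrys_κ(R)` is an abelian category. -/
instance abelianQCrys : Abelian (QCrys p R) :=
  ObjectProperty.SerreClassLocalization.abelian (toCrys p R) (LNil p R)

end Modules

end Cartier

end

/-! Call a map of Cartier modules a nil-isomorphism if its kernel and cokernel are locally
nilpotent, and call a module local if `Hom` into it turns nil-isomorphisms into bijections. The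
theorem reduces to finding a nil-isomorphism from every `M` to a local module, and unitalization
provides it.

The kernel and cokernel of `κ_M` are killed by `F`, since `φ s F = κ_M(φ(s))` for `φ` in `F^♭ M`;
passing to the colimit, `η : M ⟶ u(M)` is a nil-isomorphism (`isoModSerre_eta`). As `R` is
noetherian and `F`-finite, `F_* R` is finitely presented, so `F^♭` commutes with the colimit and `κ`
is bijective on `u(M)` (`IsKappaSystem.kappaBijective`). A module with bijective `κ` is local
(`KappaBijective.isLocal`): maps into it extend uniquely along nil-isomorphisms, because an element
is recovered from its multiples by `r F^n`. Such local replacements give a fully faithful right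
adjoint of `π` (`exists_rightAdjoint_of_local_replacement`). It preserves injectives because `π`
preserves monomorphisms, and it reflects them because it is fully faithful and preserves
monomorphisms. Comparing `η` with the unit gives `u ≅ ubar ∘ π` (`exists_unitalization_iso`).

For regular `R` the Frobenius is flat (`frob_flat_of_isRegularRing`, one direction of Kunz's
theorem), so `F_* R` is finite projective and `F^♭`, hence `u`, preserves epimorphisms. Through `u ≅
ubar ∘ π` this passes to `ubar`, which is left exact as a right adjoint. -/

namespace Cartier

/-! ### Regular local rings: regular parameters, induction on dimension, integrality. -/

section RegularLocal

open IsLocalRing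

variable {A : Type*} [CommRing A]

/-- Expand `x` in a minimal generating set. Since `x` is outside the square of the maximal ideal,
some coefficient is a unit, and `x` can replace the corresponding generator. -/
lemma exists_span_insert_eq_maximalIdeal [IsLocalRing A] [IsNoetherianRing A] {x : A}
    (hx : x ∈ maximalIdeal A) (hx' : x ∉ maximalIdeal A ^ 2) :
    ∃ T : Finset A, T.card + 1 = (maximalIdeal A).spanFinrank ∧
      Ideal.span (insert x (T : Set A)) = maximalIdeal A := by
  classical
  obtain ⟨S, hS, hspan⟩ := Submodule.FG.exists_span_finset_card_eq_spanFinrank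
    (maximalIdeal A).fg_of_isNoetherianRing
  have hxS : x ∈ Submodule.span A (S : Set A) := by rwa [hspan]
  obtain ⟨c, hc⟩ := Submodule.mem_span_finset'.1 hxS
  have hSm (s : A) (hs : s ∈ S) : s ∈ maximalIdeal A := by
    rw [← hspan]
    exact Submodule.subset_span hs
  obtain ⟨i, hi⟩ : ∃ i, c i ∉ maximalIdeal A := by
    by_contra! h
    refine hx' ?_
    rw [← hc, pow_two]
    exact Ideal.sum_mem _ fun i _ ↦ Ideal.mul_mem_mul (h i) (hSm _ i.2)
  have hu : IsUnit (c i) := by simpa using hi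
  refine ⟨S.erase i, ?_, le_antisymm ?_ ?_⟩
  · rw [Finset.card_erase_add_one i.2, hS]
  · rw [Ideal.span_le]
    rintro y (rfl | hy)
    · exact hx
    · exact hSm y (Finset.mem_of_mem_erase hy)
  · have hmem (s : A) (hs : s ∈ S) (hsi : s ≠ i) :
        s ∈ Ideal.span (insert x ((S.erase i : Finset A) : Set A)) :=
      Ideal.subset_span (Or.inr (Finset.mem_coe.2 (Finset.mem_erase.2 ⟨hsi, hs⟩)))
    nth_rw 1 [← hspan]
    refine Ideal.span_le.2 fun s hs ↦ ?_
    by_cases hsi : s = i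
    · subst hsi
      have : c i * i = x - ∑ j ∈ Finset.univ.erase i, c j * j := by
        rw [← hc, eq_sub_iff_add_eq]
        exact Finset.add_sum_erase _ (fun j ↦ c j * (j : A)) (Finset.mem_univ i)
      rw [SetLike.mem_coe, ← Ideal.unit_mul_mem_iff_mem _ hu, this]
      refine sub_mem (Ideal.subset_span (Or.inl rfl)) (Ideal.sum_mem _ fun j hj ↦
        Ideal.mul_mem_left _ _ (hmem _ j.2 fun h ↦ ?_))
      exact Finset.ne_of_mem_erase hj (Subtype.ext h)
    · exact hmem s hs hsi

lemma map_mk_maximalIdeal [IsLocalRing A] (I : Ideal A) [IsLocalRing (A ⧸ I)] :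
    Ideal.map (Ideal.Quotient.mk I) (maximalIdeal A) = maximalIdeal (A ⧸ I) := by
  have := IsLocalHom.of_surjective (Ideal.Quotient.mk I) Ideal.Quotient.mk_surjective
  rw [← ((IsLocalRing.local_hom_TFAE (Ideal.Quotient.mk I)).out 0 4 :).1 this,
    Ideal.map_comap_of_surjective _ Ideal.Quotient.mk_surjective]

/-- Killing `x` lowers the embedding dimension by at least one, as `x` belongs to a minimal
generating set, and lowers the Krull dimension by at most one. -/
lemma isRegularLocalRing_quotient_span_singleton [IsRegularLocalRing A] {x : A}
    (hx : x ∈ maximalIdeal A) (hx' : x ∉ maximalIdeal A ^ 2) :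
    IsRegularLocalRing (A ⧸ Ideal.span {x}) ∧
      (Ideal.map (Ideal.Quotient.mk (Ideal.span {x})) (maximalIdeal A)).spanFinrank + 1 ≤
        (maximalIdeal A).spanFinrank := by
  classical
  have : Nontrivial (A ⧸ Ideal.span {x}) := Ideal.Quotient.nontrivial_iff.2 fun h ↦
    (maximalIdeal.isMaximal A).ne_top (top_le_iff.1 (h ▸ (Ideal.span_singleton_le_iff_mem _).2 hx))
  have : IsLocalRing (A ⧸ Ideal.span {x}) :=
    .of_surjective' (Ideal.Quotient.mk _) Ideal.Quotient.mk_surjective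
  have hmax := map_mk_maximalIdeal (Ideal.span {x})
  obtain ⟨T, hT, hspan⟩ := exists_span_insert_eq_maximalIdeal hx hx'
  have hle : (Ideal.map (Ideal.Quotient.mk (Ideal.span {x})) (maximalIdeal A)).spanFinrank + 1 ≤
      (maximalIdeal A).spanFinrank := by
    rw [← hT, add_le_add_iff_right, ← hspan, Ideal.map_span, Set.image_insert_eq,
      Ideal.Quotient.eq_zero_iff_mem.2 (Ideal.mem_span_singleton_self x), Ideal.span_insert_zero]
    exact (Submodule.spanFinrank_span_le_ncard_of_finite (T.finite_toSet.image _)).trans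
      ((Set.ncard_image_le T.finite_toSet).trans (by simp))
  refine ⟨.of_spanFinrank_maximalIdeal_le _ ?_, hle⟩
  have h1 := ringKrullDim_le_ringKrullDim_quotient_add_card (R := A) {x}
    (by simpa [IsLocalRing.ringJacobson_eq_maximalIdeal] using hx)
  rw [← IsRegularLocalRing.spanFinrank_maximalIdeal, Finset.coe_singleton, Finset.card_singleton]
    at h1
  rw [hmax] at hle
  have h2 : (((maximalIdeal (A ⧸ Ideal.span {x})).spanFinrank + 1 : ℕ) : WithBot ℕ∞) ≤
      ringKrullDim (A ⧸ Ideal.span {x}) + 1 := le_trans (by exact_mod_cast hle) h1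
  push_cast at h2
  generalize ringKrullDim (A ⧸ Ideal.span {x}) = d at h2
  exact ENat.WithBot.add_le_add_one_right_iff.1 h2

/-- Prime avoidance for the minimal primes and `𝔪²`. If `𝔪 ⊆ 𝔪²`, Nakayama gives `𝔪 = 0`; if `𝔪` is
a minimal prime, the dimension is zero and regularity gives `𝔪 = 0`. -/
lemma exists_mem_maximalIdeal_notMem [IsRegularLocalRing A] (hA : ¬ IsField A) :
    ∃ x ∈ maximalIdeal A, x ∉ maximalIdeal A ^ 2 ∧ ∀ P ∈ minimalPrimes A, x ∉ P := by
  classical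
  have hfin : (minimalPrimes A).Finite := minimalPrimes.finite_of_isNoetherianRing A
  by_contra! h
  have hsub : ((maximalIdeal A : Ideal A) : Set A) ⊆
      ⋃ I ∈ ((insert (maximalIdeal A ^ 2) hfin.toFinset : Finset (Ideal A)) : Set (Ideal A)),
        (I : Set A) := by
    intro x hx
    by_cases hx2 : x ∈ maximalIdeal A ^ 2
    · exact Set.mem_biUnion (by simp) hx2
    · obtain ⟨P, hP, hxP⟩ := h x hx hx2
      exact Set.mem_biUnion (by simp [hP]) hxP
  -- Prime avoidance tolerates two non-prime ideals; `𝔪²` fills both slots.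
  obtain ⟨I, hI, hle⟩ := (Ideal.subset_union_prime (f := id) (maximalIdeal A ^ 2)
    (maximalIdeal A ^ 2) (fun I hI h1 _ ↦ by
      simp only [Finset.mem_insert, Set.Finite.mem_toFinset] at hI
      exact (hI.resolve_left h1).1.1)).1 hsub
  refine hA (isField_iff_maximalIdeal_eq.2 ?_)
  simp only [Finset.mem_insert, Set.Finite.mem_toFinset, id] at hI hle
  obtain rfl | hI := hI
  · refine Submodule.eq_bot_of_le_smul_of_le_jacobson_bot (maximalIdeal A) _
      (maximalIdeal A).fg_of_isNoetherianRing ?_ (maximalIdeal_le_jacobson _)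
    rwa [smul_eq_mul, ← pow_two]
  · have hm : maximalIdeal A ∈ minimalPrimes A := by
      rwa [(maximalIdeal.isMaximal A).eq_of_le hI.1.1.ne_top hle]
    have h0 : ringKrullDim A = 0 := by
      rw [← maximalIdeal_height_eq_ringKrullDim, Ideal.height_eq_zero_iff.2 hm]
      rfl
    rw [← IsRegularLocalRing.spanFinrank_maximalIdeal] at h0
    have h1 : (maximalIdeal A).spanFinrank = 0 := by exact_mod_cast h0
    have h2 := (Submodule.FG.spanRank_eq_iff (maximalIdeal A).fg_of_isNoetherianRing 0).2 h1
    exact Submodule.spanRank_eq_zero_iff_eq_bot.1 (by simpa using h2)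

/-- Induction on the dimension of a regular local ring, by quotients by regular parameters outside
all minimal primes. -/
lemma regularLocalRing_induction {P : (A : Type u) → [CommRing A] → Prop}
    (field : ∀ (A : Type u) [CommRing A], IsField A → P A)
    (quot : ∀ (A : Type u) [CommRing A] [IsRegularLocalRing A] (x : A), x ∈ maximalIdeal A →
      (∀ p ∈ minimalPrimes A, x ∉ p) → IsRegularLocalRing (A ⧸ Ideal.span {x}) →
      P (A ⧸ Ideal.span {x}) → P A) (A : Type u) [CommRing A] [IsRegularLocalRing A] : P A := by
  induction hn : (maximalIdeal A).spanFinrank using Nat.strong_induction_on generalizing A with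
  | h n ih =>
    by_cases hA : IsField A
    · exact field A hA
    · obtain ⟨x, hx, hx2, hmin⟩ := exists_mem_maximalIdeal_notMem hA
      obtain ⟨hreg, hlt⟩ := isRegularLocalRing_quotient_span_singleton hx hx2
      refine quot A x hx hmin hreg (ih _ ?_ (A ⧸ Ideal.span {x}) rfl)
      rw [← map_mk_maximalIdeal]
      omega

/-- By induction `(x)` is prime, so it contains a minimal prime `P`. As `x ∉ P`, every element of
`P` is `x` times an element of `P`, and Nakayama gives `P = 0`. -/
theorem isDomain_of_isRegularLocalRing (A : Type u) [CommRing A] [IsRegularLocalRing A] :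
    IsDomain A := by
  refine regularLocalRing_induction (P := fun A _ ↦ IsDomain A) (fun A _ hA ↦ ?_)
    (fun A _ _ x hx hmin _ hdom ↦ ?_) A
  · exact hA.isDomain
  · have : IsDomain (A ⧸ Ideal.span {x}) := hdom
    have hxp : (Ideal.span {x}).IsPrime := (Ideal.Quotient.isDomain_iff_prime _).1 hdom
    obtain ⟨P, hP, hle⟩ := Ideal.exists_minimalPrimes_le (bot_le : ⊥ ≤ Ideal.span {x})
    have hPp : P.IsPrime := hP.1.1
    have hP0 : P = ⊥ := by
      refine Submodule.eq_bot_of_le_smul_of_le_jacobson_bot (maximalIdeal A) _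
        P.fg_of_isNoetherianRing (fun y hy ↦ ?_) (maximalIdeal_le_jacobson _)
      obtain ⟨z, rfl⟩ := Ideal.mem_span_singleton'.1 (hle hy)
      rw [mul_comm]
      exact Ideal.mul_mem_mul hx ((hPp.mem_or_mem hy).resolve_right (hmin P hP))
    subst hP0
    exact IsDomain.of_bot_isPrime A

end RegularLocal

/-! ### Flatness of the Frobenius of a regular ring. -/

section FrobeniusFlat

open IsLocalRing

/-- The target of a ring homomorphism is free as a module over its source. -/
def FreeHom {A B : Type*} [CommRing A] [CommRing B] (f : A →+* B) : Prop :=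
  letI := f.toAlgebra
  Module.Free A B

lemma freeHom_of_flat {A B : Type*} [CommRing A] [CommRing B] [IsLocalRing A] {f : A →+* B}
    (hf : f.Finite) (hf' : f.Flat) : FreeHom f := by
  algebraize [f]
  exact (Module.free_of_flat_of_isLocalRing : Module.Free A B)

lemma finite_of_generators {A B : Type*} [CommRing A] [CommRing B] {f : A →+* B} (T : Finset B)
    (hT : ∀ P : B → Prop, (∀ t ∈ T, P t) → P 0 → (∀ x y, P x → P y → P (x + y)) →
      (∀ s x, P x → P (x * f s)) → ∀ b, P b) : f.Finite := by
  let := f.toAlgebra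
  refine ⟨T, eq_top_iff.2 fun z _ ↦ hT (fun z ↦ z ∈ Submodule.span A (T : Set B))
    (fun t ht ↦ Submodule.subset_span ht) (zero_mem _) (fun _ _ ↦ add_mem) (fun s x hx ↦ ?_) z⟩
  have : x * f s = s • x := by rw [Algebra.smul_def, mul_comm]; rfl
  rw [this]
  exact Submodule.smul_mem _ _ hx

open nonZeroDivisors Pointwise in
-- Freeness of a finite module over a noetherian local ring can be tested modulo an element of the
-- maximal ideal that is regular on the module; here `B / xB` is `B / (f x)`.
lemma flat_of_freeHom_quotient {A B : Type*} [CommRing A] [CommRing B] [IsLocalRing A]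
    [IsNoetherianRing A] {f : A →+* B} (hf : f.Finite) {x : A} (hx : x ∈ maximalIdeal A)
    (hreg : f x ∈ B⁰) (g : A ⧸ Ideal.span {x} →+* B ⧸ Ideal.span {f x})
    (hg : g.comp (Ideal.Quotient.mk _) = (Ideal.Quotient.mk _).comp f) (hfree : FreeHom g) :
    f.Flat := by
  have : Nontrivial (A ⧸ Ideal.span {x}) := Ideal.Quotient.nontrivial_iff.2 fun h ↦
    (maximalIdeal.isMaximal A).ne_top (top_le_iff.1 (h ▸ (Ideal.span_singleton_le_iff_mem _).2 hx))
  have : IsLocalRing (A ⧸ Ideal.span {x}) :=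
    .of_surjective' (Ideal.Quotient.mk _) Ideal.Quotient.mk_surjective
  algebraize [f, g]
  have : Module.Free (A ⧸ Ideal.span {x}) (B ⧸ Ideal.span {f x}) := hfree
  have : IsScalarTower A (A ⧸ Ideal.span {x}) (B ⧸ Ideal.span {f x}) :=
    .of_algebraMap_eq fun a ↦ (congrArg (fun h ↦ h a) hg).symm
  have heq : (x • ⊤ : Submodule A B) = (Ideal.span {f x}).restrictScalars A := by
    ext b
    simp only [Submodule.mem_smul_pointwise_iff_exists, Submodule.mem_top, true_and,
      Submodule.restrictScalars_mem, Ideal.mem_span_singleton', Algebra.smul_def]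
    exact exists_congr fun c ↦ by rw [mul_comm c]; rfl
  let e : QuotSMulTop x B ≃ₗ[A ⧸ Ideal.span {x}] B ⧸ Ideal.span {f x} :=
    ((Submodule.quotEquivOfEq _ _ heq).trans
      (Submodule.Quotient.restrictScalarsEquiv A (Ideal.span {f x}))).extendScalarsOfSurjective
        Ideal.Quotient.mk_surjective
  have hfree' : Module.Free (A ⧸ Ideal.span {x}) (QuotSMulTop x B) := Module.Free.of_equiv e.symm
  have : Module.FinitePresentation A B := Module.finitePresentation_of_finite A B
  have : Module.Free A B := (Module.free_quotSMulTop_iff_free A B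
    (maximalIdeal_le_jacobson _ hx) fun a b h ↦ by
      simp only [Algebra.smul_def] at h
      exact (mul_cancel_left_mem_nonZeroDivisors hreg).1 h).1 hfree'
  change Module.Flat A B
  infer_instance

lemma free_of_exact {S X Y Z : Type u} [CommRing S] [AddCommGroup X] [AddCommGroup Y]
    [AddCommGroup Z] [Module S X] [Module S Y] [Module S Z] [Module.Free S X] [Module.Free S Z]
    (a : X →ₗ[S] Y) (c : Y →ₗ[S] Z) (ha : Function.Injective a) (hc : Function.Surjective c)
    (h : Function.Exact a c) : Module.Free S Y := by
  let T : ShortComplex (ModuleCat.{u} S) := .mk (ModuleCat.ofHom a) (ModuleCat.ofHom c) (by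
    ext b
    exact h.apply_apply_eq_zero b)
  have hT : T.ShortExact :=
    { exact := (ShortComplex.moduleCat_exact_iff T).2 fun b hb ↦ (h b).1 hb
      mono_f := (ModuleCat.mono_iff_injective _).2 ha
      epi_g := (ModuleCat.epi_iff_surjective _).2 hc }
  have : Module.Free S T.X₁ := ‹Module.Free S X›
  have : Module.Free S T.X₃ := ‹Module.Free S Z›
  exact ModuleCat.free_shortExact hT

open nonZeroDivisors in
-- Multiplication by `y ^ k` gives a short exact sequence `0 → B/y → B/y^(k+1) → B/y^k → 0`. The
-- function `f`, not assumed to be a homomorphism, lifts all three structure maps at once and so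
-- makes the sequence `S`-linear.
lemma free_quotient_span_pow_succ {S B : Type u} [CommRing S] [CommRing B] {y : B} (hy : y ∈ B⁰)
    {k : ℕ} {g₁ : S →+* B ⧸ Ideal.span {y}} {gk : S →+* B ⧸ Ideal.span {y ^ k}}
    {g : S →+* B ⧸ Ideal.span {y ^ (k + 1)}} (f : S → B)
    (h₁ : ∀ s, g₁ s = Ideal.Quotient.mk _ (f s)) (hk : ∀ s, gk s = Ideal.Quotient.mk _ (f s))
    (h : ∀ s, g s = Ideal.Quotient.mk _ (f s))
    (hg₁ : FreeHom g₁) (hgk : FreeHom gk) : FreeHom g := by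
  let := g₁.toAlgebra
  let := gk.toAlgebra
  let := g.toAlgebra
  have : Module.Free S (B ⧸ Ideal.span {y}) := hg₁
  have : Module.Free S (B ⧸ Ideal.span {y ^ k}) := hgk
  change Module.Free S (B ⧸ Ideal.span {y ^ (k + 1)})
  let a₀ : (B ⧸ Ideal.span {y}) →ₗ[B] (B ⧸ Ideal.span {y ^ (k + 1)}) :=
    Submodule.mapQ (Ideal.span {y}) (Ideal.span {y ^ (k + 1)}) (LinearMap.mulLeft B (y ^ k)) (by
      rw [Ideal.span, Submodule.span_le, Set.singleton_subset_iff]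
      exact Ideal.mem_span_singleton.2 (by simp [pow_succ]))
  let a : (B ⧸ Ideal.span {y}) →ₗ[S] (B ⧸ Ideal.span {y ^ (k + 1)}) :=
    { toFun := a₀
      map_add' := a₀.map_add
      map_smul' := fun s b ↦ by
        change a₀ (g₁ s * b) = g s * a₀ b
        rw [h₁, h]
        exact a₀.map_smul (f s) b }
  let c : (B ⧸ Ideal.span {y ^ (k + 1)}) →ₗ[S] (B ⧸ Ideal.span {y ^ k}) :=
    { toFun := Ideal.Quotient.factor (Ideal.span_singleton_le_span_singleton.2
        (pow_dvd_pow y k.le_succ))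
      map_add' := map_add _
      map_smul' := fun s b ↦ by
        change Ideal.Quotient.factor _ (g s * b) = gk s * _
        rw [map_mul, h, hk, Ideal.Quotient.factor_mk] }
  have ha (b : B) : a (Ideal.Quotient.mk _ b) = Ideal.Quotient.mk _ (y ^ k * b) := rfl
  have hc (b : B) : c (Ideal.Quotient.mk _ b) = Ideal.Quotient.mk _ b := rfl
  have hainj : Function.Injective a := by
    rw [injective_iff_map_eq_zero]
    intro b hb
    obtain ⟨b, rfl⟩ := Ideal.Quotient.mk_surjective b
    rw [ha, Ideal.Quotient.eq_zero_iff_mem, Ideal.mem_span_singleton] at hb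
    rw [Ideal.Quotient.eq_zero_iff_mem, Ideal.mem_span_singleton]
    obtain ⟨z, hz⟩ := hb
    rw [pow_succ, mul_assoc, mul_cancel_left_mem_nonZeroDivisors (pow_mem hy k)] at hz
    exact ⟨z, hz⟩
  have hcsurj : Function.Surjective c := fun b ↦ by
    obtain ⟨b, rfl⟩ := Ideal.Quotient.mk_surjective b
    exact ⟨Ideal.Quotient.mk _ b, hc b⟩
  have hac (b : B ⧸ Ideal.span {y}) : c (a b) = 0 := by
    obtain ⟨b, rfl⟩ := Ideal.Quotient.mk_surjective b
    rw [ha, hc, Ideal.Quotient.eq_zero_iff_mem]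
    exact Ideal.mul_mem_right _ _ (Ideal.mem_span_singleton_self _)
  have hex (b : B ⧸ Ideal.span {y ^ (k + 1)}) (hb : c b = 0) : ∃ b', a b' = b := by
    obtain ⟨b, rfl⟩ := Ideal.Quotient.mk_surjective b
    rw [hc, Ideal.Quotient.eq_zero_iff_mem, Ideal.mem_span_singleton] at hb
    obtain ⟨z, rfl⟩ := hb
    exact ⟨Ideal.Quotient.mk _ z, ha z⟩
  exact free_of_exact a c hainj hcsurj fun b ↦ ⟨hex b, by rintro ⟨b, rfl⟩; exact hac b⟩

variable (p : ℕ) [Fact p.Prime]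

instance FFinite.quotient (A : Type u) [CommRing A] [Algebra (ZMod p) A] [FFinite p A]
    (I : Ideal A) : FFinite p (A ⧸ I) where
  finite_frob := by
    have h : (frob p (A ⧸ I)).comp (Ideal.Quotient.mk I) = (Ideal.Quotient.mk I).comp (frob p A) :=
      RingHom.ext fun a ↦ by simp
    refine RingHom.Finite.of_comp_finite (f := Ideal.Quotient.mk I) ?_
    rw [h]
    exact (RingHom.Finite.of_surjective _ Ideal.Quotient.mk_surjective).comp FFinite.finite_frob

instance FFinite.localization (A : Type u) [CommRing A] [Algebra (ZMod p) A] [FFinite p A]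
    (M : Submonoid A) : FFinite p (Localization M) where
  finite_frob := by
    classical
    obtain ⟨T, hT⟩ := exists_generators (FFinite.finite_frob (p := p) (R := A))
    refine finite_of_generators (T.image (algebraMap A (Localization M)))
      fun P hP hP0 hadd hmul z ↦ ?_
    have key (a : A) : P (algebraMap A (Localization M) a) := by
      refine hT (fun a ↦ P (algebraMap A (Localization M) a))
        (fun t ht ↦ hP _ (Finset.mem_image_of_mem _ ht)) (by simpa using hP0)
        (fun x y hx hy ↦ ?_) (fun s x hx ↦ ?_) a
      · rw [map_add]
        exact hadd _ _ hx hy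
      · have := hmul (algebraMap A (Localization M) s) _ hx
        rwa [frob_apply, ← map_pow, ← map_mul] at this
    obtain ⟨a, s, rfl⟩ := IsLocalization.exists_mk'_eq M z
    have hp : p - 1 + 1 = p := Nat.succ_pred_prime Fact.out
    -- `a / s = a s^(p-1) · (1/s)^p`, so generators over the Frobenius of `A` still generate.
    have : IsLocalization.mk' (Localization M) a s =
        algebraMap A (Localization M) (a * (s : A) ^ (p - 1)) *
          frob p _ (IsLocalization.mk' (Localization M) 1 s) := by
      rw [frob_apply, IsLocalization.mk'_eq_iff_eq_mul]
      have h1 : IsLocalization.mk' (Localization M) 1 s * algebraMap A (Localization M) s = 1 := by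
        simp
      calc algebraMap A (Localization M) a
          = (IsLocalization.mk' (Localization M) 1 s * algebraMap A (Localization M) s) ^
              (p - 1 + 1) * algebraMap A (Localization M) a := by rw [h1]; simp
        _ = _ := by
            rw [mul_pow, hp, map_mul, map_pow]
            nth_rw 2 [← hp]
            ring
    rw [this]
    exact hmul _ _ (key _)

/-- The Frobenius of an `F`-finite regular local ring is flat. -/
theorem frob_flat_of_isRegularLocalRing (A : Type u) [CommRing A] [IsRegularLocalRing A]
    [Algebra (ZMod p) A] [FFinite p A] : (frob p A).Flat := by
  refine regularLocalRing_induction (P := fun A _ ↦ ∀ [Algebra (ZMod p) A] [FFinite p A],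
    (frob p A).Flat) (fun A _ hA _ _ ↦ RingHom.Flat.of_isField hA _)
    (fun A _ _ x hx hmin hreg ih _ _ ↦ ?_) A
  have : IsDomain A := isDomain_of_isRegularLocalRing A
  -- In a domain the zero ideal is the minimal prime, so avoiding minimal primes means being
  -- nonzero.
  have hx0 : x ∈ nonZeroDivisors A := mem_nonZeroDivisors_of_ne_zero fun h ↦
    hmin ⊥ (by rw [IsDomain.minimalPrimes_eq_singleton_bot]; rfl) (by simp [h])
  have hle (k : ℕ) (hk : k ≤ p) :
      Ideal.span {x} ≤ (Ideal.span {x ^ k}).comap (frob p A) := by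
    rw [Ideal.span_singleton_le_iff_mem, Ideal.mem_comap, frob_apply]
    exact Ideal.mem_span_singleton.2 (pow_dvd_pow x hk)
  let g (k : ℕ) (hk : k ≤ p) := Ideal.quotientMap (Ideal.span {x ^ k}) (frob p A) (hle k hk)
  let σ : A ⧸ Ideal.span {x} → A := Function.surjInv Ideal.Quotient.mk_surjective
  have hσ (s : A ⧸ Ideal.span {x}) : Ideal.Quotient.mk _ (σ s) = s :=
    Function.surjInv_eq Ideal.Quotient.mk_surjective s
  have hgσ (k : ℕ) (hk : k ≤ p) (s : A ⧸ Ideal.span {x}) :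
      g k hk s = Ideal.Quotient.mk _ (frob p A (σ s)) := by
    conv_lhs => rw [← hσ s]
    exact Ideal.quotientMap_mk
  -- Let `A/x` act on `A/x^k` through the Frobenius of `A`, for `k ≤ p`. The graded pieces are `A/x`
  -- acting on itself through its own Frobenius, which is free by the induction hypothesis; `k = p`
  -- is the reduction of the Frobenius of `A` modulo `x`.
  have hfree (k : ℕ) (hk : k ≤ p) : FreeHom (g k hk) := by
    induction k with
    | zero =>
      have : Subsingleton (A ⧸ Ideal.span {x ^ 0}) := by
        rw [Ideal.Quotient.subsingleton_iff]
        simp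
      let := (g 0 hk).toAlgebra
      exact Module.Free.of_subsingleton _ _
    | succ k ih' =>
      refine free_quotient_span_pow_succ hx0 (g₁ := frob p (A ⧸ Ideal.span {x}))
        (fun s ↦ frob p A (σ s)) (fun s ↦ ?_) (hgσ k (k.le_succ.trans hk)) (hgσ _ hk)
        (freeHom_of_flat FFinite.finite_frob ih) (ih' (k.le_succ.trans hk))
      conv_lhs => rw [← hσ s]
      simp
  exact flat_of_freeHom_quotient FFinite.finite_frob hx (pow_mem hx0 p) (g p le_rfl)
    (Ideal.quotientMap_comp_mk _) (hfree p le_rfl)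

/-- The Frobenius of an `F`-finite regular ring is flat. -/
theorem frob_flat_of_isRegularRing (R : Type u) [CommRing R] [IsRegularRing R]
    [Algebra (ZMod p) R] [FFinite p R] : (frob p R).Flat := by
  refine RingHom.Flat.ofLocalizationPrime _ fun P _ ↦ ?_
  -- The Frobenius contracts `P` to itself, but only propositionally; a separate `Q` allows
  -- substitution.
  have key (Q : Ideal R) [Q.IsPrime] (h : Q = P.comap (frob p R)) (hQ : Q = P) :
      (Localization.localRingHom Q P (frob p R) h).Flat := by
    subst hQ
    rw [Localization.localRingHom_unique Q Q (frob p R) h (j := frob p (Localization.AtPrime Q))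
      fun r ↦ by simp]
    exact frob_flat_of_isRegularLocalRing p _
  refine key _ rfl (Ideal.ext fun r ↦ ?_)
  rw [Ideal.mem_comap, frob_apply]
  exact Ideal.IsPrime.pow_mem_iff_mem inferInstance p (Fact.out : p.Prime).pos

end FrobeniusFlat

/-! ### Cartier modules with bijective `κ` are local. -/

section Closed

variable {p : ℕ} [Fact p.Prime] {R : Type u} [CommRing R] [Algebra (ZMod p) R]

lemma op_F_pow_succ_smul {M : QCoh p R} (n : ℕ) (m : M) :
    (op (F p R ^ (n + 1)) • m : M) = op (F p R ^ n) • op (F p R) • m := by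
  rw [← mul_smul, ← op_mul, pow_succ']

lemma op_F_pow_succ_smul' {M : QCoh p R} (n : ℕ) (m : M) :
    (op (F p R ^ (n + 1)) • m : M) = op (F p R) • op (F p R ^ n) • m := by
  rw [← mul_smul, ← op_mul, pow_succ]

lemma op_coeff_mul_smul {M : QCoh p R} (r s : R) (m : M) :
    (op (coeff p R (r * s)) • m : M) = op (coeff p R r) • op (coeff p R s) • m := by
  rw [← mul_smul, ← op_mul, ← map_mul, mul_comm]

lemma frob_pow_succ_apply (n : ℕ) (r : R) :
    (frob p R ^ (n + 1)) r = (frob p R ^ n) (frob p R r) := by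
  rw [pow_succ]
  rfl

/-- The adjoint structural map of `N` is bijective, in terms of elements. -/
structure KappaBijective (N : QCoh p R) : Prop where
  eq_zero (n : N) (h : ∀ r : R, (op (F p R) • op (coeff p R r) • n : N) = 0) : n = 0
  exists_eq (φ : R →+ N) (h : ∀ s r, φ (frob p R s * r) = op (coeff p R s) • φ r) :
    ∃ n : N, ∀ r, φ r = op (F p R) • op (coeff p R r) • n

/-- If `n` lies in level `e + 1`, each `n r F` lies in level `e`, because `(n r F) s F^e = n (r s^p)
F^(e+1)`. -/
lemma KappaBijective.eq_zero_of_mem_nilSubmodule {N : QCoh p R} (hN : KappaBijective N) {n : N}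
    {e : ℕ} (h : n ∈ nilSubmodule N e) : n = 0 := by
  induction e generalizing n with
  | zero => simpa using h 1
  | succ e ih =>
    refine hN.eq_zero n fun r ↦ ih fun s ↦ ?_
    rw [← op_F_smul_op_coeff_smul, ← op_coeff_mul_smul, ← op_F_pow_succ_smul]
    exact h _

/-- The `e`-fold iterate of `κ` is also surjective. For fixed `t`, `r ↦ φ(r^(p^e) t)` comes from a
unique `ψ(t)`; uniqueness makes `ψ` additive and `p^e`-linear, and the induction hypothesis applies
to `ψ`. -/
lemma KappaBijective.exists_eq_pow {N : QCoh p R} (hN : KappaBijective N) (e : ℕ) (φ : R →+ N)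
    (h : ∀ s r, φ ((frob p R ^ e) s * r) = op (coeff p R s) • φ r) :
    ∃ n : N, ∀ r, φ r = op (F p R ^ e) • op (coeff p R r) • n := by
  induction e generalizing φ with
  | zero =>
    refine ⟨φ 1, fun r ↦ ?_⟩
    have := h r 1
    rw [mul_one] at this
    simpa using this
  | succ e ih =>
    have hψ (t : R) : ∃ n : N, ∀ r, φ ((frob p R ^ e) r * t) = op (F p R) • op (coeff p R r) • n :=
      hN.exists_eq
        { toFun := fun r ↦ φ ((frob p R ^ e) r * t)
          map_zero' := by simp
          map_add' := fun r s ↦ by simp [add_mul] } fun s r ↦ by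
            change φ _ = _ • φ _
            rw [map_mul (frob p R ^ e), ← frob_pow_succ_apply, mul_assoc, h]
    choose ψ hψ using hψ
    have huniq (t : R) (n : N) (hn : ∀ r, φ ((frob p R ^ e) r * t) =
        op (F p R) • op (coeff p R r) • n) : ψ t = n := by
      rw [← sub_eq_zero]
      refine hN.eq_zero _ fun r ↦ ?_
      rw [smul_sub, smul_sub, ← hψ, ← hn, sub_self]
    obtain ⟨n, hn⟩ := ih
      { toFun := ψ
        map_zero' := huniq _ _ fun r ↦ by simp
        map_add' := fun s t ↦ huniq _ _ fun r ↦ by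
          rw [mul_add, map_add, hψ, hψ, smul_add, smul_add] } fun s t ↦ huniq _ _ fun r ↦ by
            rw [← mul_assoc, ← map_mul, hψ, op_coeff_mul_smul]
            rfl
    refine ⟨n, fun r ↦ ?_⟩
    have h1 := hψ r 1
    rw [map_one, one_mul, map_one, op_one, one_smul] at h1
    rw [h1, op_F_pow_succ_smul', ← hn]
    rfl

lemma LNil_kernel_iff {A B : QCoh p R} (f : A ⟶ B) :
    LNil p R (kernel f) ↔ ∀ a, f.hom a = 0 → ∃ n, a ∈ nilSubmodule A n := by
  rw [LNil_iff]
  constructor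
  · intro h a ha
    let k : (kernel f : QCoh p R) := (ModuleCat.kernelIsoKer f).inv.hom ⟨a, ha⟩
    have hk : (kernel.ι f).hom k = a :=
      congrArg (fun g ↦ g.hom ⟨a, ha⟩) (ModuleCat.kernelIsoKer_inv_kernel_ι f)
    obtain ⟨n, hn⟩ := h k
    exact ⟨n, hk ▸ mem_nilSubmodule_map _ hn⟩
  · intro h k
    obtain ⟨n, hn⟩ := h ((kernel.ι f).hom k) (congrArg (fun g ↦ g.hom k) (kernel.condition f))
    refine ⟨n, fun r ↦ (ModuleCat.mono_iff_injective (kernel.ι f)).1 inferInstance ?_⟩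
    have := hn r
    rw [← map_smul, ← map_smul] at this
    exact this.trans (map_zero (kernel.ι f).hom).symm

lemma LNil_cokernel_iff {A B : QCoh p R} (f : A ⟶ B) :
    LNil p R (cokernel f) ↔
      ∀ b : B, ∃ n, ∀ r, ∃ a, f.hom a = op (F p R ^ n) • op (coeff p R r) • b := by
  rw [LNil_iff]
  have hex (b : B) : (cokernel.π f).hom b = 0 ↔ ∃ a, f.hom a = b := by
    refine ⟨fun hb ↦ ?_, ?_⟩
    · exact (ShortComplex.moduleCat_exact_iff _).1 (ShortComplex.exact_cokernel f) b hb
    · rintro ⟨a, rfl⟩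
      exact congrArg (fun g ↦ g.hom a) (cokernel.condition f)
  have hmem (b : B) (n : ℕ) : (cokernel.π f).hom b ∈ nilSubmodule (cokernel f) n ↔
      ∀ r, ∃ a, f.hom a = op (F p R ^ n) • op (coeff p R r) • b :=
    forall_congr' fun r ↦ by rw [← map_smul, ← map_smul, hex]
  simp_rw [← hmem]
  refine ⟨fun h b ↦ h _, fun h c ↦ ?_⟩
  obtain ⟨b, rfl⟩ := (ModuleCat.epi_iff_surjective (cokernel.π f)).1 inferInstance c
  exact h b

variable [FFinite p R]

lemma isoModSerre_LNil_iff {A B : QCoh p R} (f : A ⟶ B) :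
    (LNil p R).isoModSerre f ↔ (∀ a, f.hom a = 0 → ∃ n, a ∈ nilSubmodule A n) ∧
      ∀ b : B, ∃ n, ∀ r, ∃ a, f.hom a = op (F p R ^ n) • op (coeff p R r) • b := by
  rw [← LNil_kernel_iff, ← LNil_cokernel_iff]
  rfl

/-- Cartier modules with bijective adjoint structural map are local with respect to the morphisms
with locally nilpotent kernel and cokernel. -/
theorem KappaBijective.isLocal {N : QCoh p R} (hN : KappaBijective N) :
    (LNil p R).isoModSerre.isLocal N := by
  intro A B s hs
  rw [isoModSerre_LNil_iff] at hs
  obtain ⟨hker, hcoker⟩ := hs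
  constructor
  · intro g₁ g₂ hg
    ext b
    rw [← sub_eq_zero]
    obtain ⟨n, hn⟩ := hcoker b
    refine hN.eq_zero_of_mem_nilSubmodule (e := n) fun r ↦ ?_
    obtain ⟨a, ha⟩ := hn r
    have hga : g₁.hom (s.hom a) = g₂.hom (s.hom a) := congrArg (fun g ↦ g.hom a) hg
    rw [ha, map_smul, map_smul, map_smul, map_smul] at hga
    rw [smul_sub, smul_sub, hga, sub_self]
  · intro f
    have hf0 (a : A) (ha : s.hom a = 0) : f.hom a = 0 := by
      obtain ⟨n, hn⟩ := hker a ha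
      exact hN.eq_zero_of_mem_nilSubmodule (mem_nilSubmodule_map f hn)
    have hfeq (a a' : A) (ha : s.hom a = s.hom a') : f.hom a = f.hom a' := by
      rw [← sub_eq_zero, ← map_sub]
      exact hf0 _ (by rw [map_sub, ha, sub_self])
    have hmono (b : B) (x : N) (n k : ℕ) (hx : ∀ r, ∃ a, s.hom a =
        op (F p R ^ n) • op (coeff p R r) • b ∧ f.hom a = op (F p R ^ n) • op (coeff p R r) • x)
        (r : R) : ∃ a, s.hom a = op (F p R ^ (n + k)) • op (coeff p R r) • b ∧
          f.hom a = op (F p R ^ (n + k)) • op (coeff p R r) • x := by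
      obtain ⟨a, ha, ha'⟩ := hx r
      refine ⟨op (F p R ^ k) • a, ?_, ?_⟩
      · rw [map_smul, ha, ← mul_smul, ← op_mul, ← pow_add]
      · rw [map_smul, ha', ← mul_smul, ← op_mul, ← pow_add]
    -- The extension of `f` at `b` is characterized as the only `x` such that, for some `n`, every
    -- `b r F^n` has a preimage under `s` which `f` sends to `x r F^n`. Existence and all linearity
    -- properties follow from this.
    have huniq (b : B) (x y : N)
        (hx : ∃ n, ∀ r, ∃ a, s.hom a = op (F p R ^ n) • op (coeff p R r) • b ∧
          f.hom a = op (F p R ^ n) • op (coeff p R r) • x)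
        (hy : ∃ n, ∀ r, ∃ a, s.hom a = op (F p R ^ n) • op (coeff p R r) • b ∧
          f.hom a = op (F p R ^ n) • op (coeff p R r) • y) : x = y := by
      obtain ⟨n, hx⟩ := hx
      obtain ⟨k, hy⟩ := hy
      rw [← sub_eq_zero]
      refine hN.eq_zero_of_mem_nilSubmodule (e := n + k) fun r ↦ ?_
      obtain ⟨a, ha, ha'⟩ := hmono b x n k hx r
      obtain ⟨c, hc, hc'⟩ := hmono b y k n hy r
      rw [add_comm k n] at hc hc'
      rw [smul_sub, smul_sub, ← ha', ← hc', hfeq a c (ha.trans hc.symm), sub_self]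
    have hexists (b : B) : ∃ x : N, ∃ n, ∀ r, ∃ a,
        s.hom a = op (F p R ^ n) • op (coeff p R r) • b ∧
          f.hom a = op (F p R ^ n) • op (coeff p R r) • x := by
      obtain ⟨n, hn⟩ := hcoker b
      choose a ha using hn
      -- Sending `r` to the value of `f` on a preimage of `b r F^n` is additive and `p^n`-linear,
      -- since `f` kills the kernel of `s`.
      obtain ⟨x, hx⟩ := hN.exists_eq_pow n
        { toFun := fun r ↦ f.hom (a r)
          map_zero' := hf0 _ (by simp [ha])
          map_add' := fun r t ↦ by
            rw [← map_add]
            refine hfeq _ _ ?_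
            rw [map_add, ha, ha, ha, map_add, MulOpposite.op_add, add_smul, smul_add] } fun t r ↦ by
            change f.hom _ = _ • f.hom _
            rw [← map_smul]
            refine hfeq _ _ ?_
            rw [map_smul, ha, ha, op_coeff_mul_smul, op_F_pow_smul_op_coeff_smul]
      exact ⟨x, n, fun r ↦ ⟨a r, ha r, hx r⟩⟩
    choose g hg using hexists
    have gadd (b c : B) : g (b + c) = g b + g c := by
      refine huniq _ _ _ (hg _) ?_
      obtain ⟨n, hb⟩ := hg b
      obtain ⟨k, hc⟩ := hg c
      refine ⟨n + k, fun r ↦ ?_⟩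
      obtain ⟨a, ha, ha'⟩ := hmono _ _ n k hb r
      obtain ⟨d, hd, hd'⟩ := hmono _ _ k n hc r
      rw [add_comm k n] at hd hd'
      exact ⟨a + d, by rw [map_add, ha, hd, smul_add, smul_add],
        by rw [map_add, ha', hd', smul_add, smul_add]⟩
    let g' : B →+ N := AddMonoidHom.mk' g gadd
    let G : B ⟶ N := ModuleCat.ofHom
      { toFun := g'
        map_add' := g'.map_add
        map_smul' := map_smul_of_generators g'
          (fun r b ↦ by
            refine huniq _ _ _ (hg _) ?_
            obtain ⟨n, hb⟩ := hg b
            refine ⟨n, fun t ↦ ?_⟩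
            obtain ⟨a, ha, ha'⟩ := hb (t * r)
            refine ⟨a, ?_, ?_⟩
            · rw [ha, op_coeff_mul_smul]
            · rw [ha', op_coeff_mul_smul]
              rfl)
          (fun b ↦ by
            refine huniq _ _ _ (hg _) ?_
            obtain ⟨n, hb⟩ := hg b
            refine ⟨n, fun t ↦ ?_⟩
            -- Uses `(b F) t F^n = b t^p F^(n+1)`.
            obtain ⟨a, ha, ha'⟩ := hb (frob p R t)
            refine ⟨op (F p R) • a, ?_, ?_⟩
            · rw [map_smul, ha, ← op_F_pow_succ_smul', op_F_pow_succ_smul, op_F_smul_op_coeff_smul]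
            · rw [map_smul, ha', ← op_F_pow_succ_smul', op_F_pow_succ_smul,
                op_F_smul_op_coeff_smul]
              rfl) }
    refine ⟨G, ?_⟩
    ext a
    exact huniq (s.hom a) _ _ (hg _) ⟨0, fun r ↦ ⟨op (coeff p R r) • a, by simp, by simp⟩⟩

end Closed

/-! ### The system of iterates of `F^♭` and its colimit. -/

section Flat

variable {p : ℕ} [Fact p.Prime] {R : Type u} [CommRing R] [Algebra (ZMod p) R]

/-- The value at `s` of an element of `F^♭ M = Hom_R(F_* R, M)`. -/
noncomputable def flatEval {M : QCoh p R} (φ : (flat p R).obj M) (s : R) : M :=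
  (show (ModuleCat.restrictScalars (frob p R)).obj (ModuleCat.of R R) →ₗ[R]
    (underlying p R).obj M from φ) s

lemma flatEval_ext {M : QCoh p R} {φ ψ : (flat p R).obj M}
    (h : ∀ s, flatEval φ s = flatEval ψ s) : φ = ψ :=
  LinearMap.ext (σ := RingHom.id R) h

lemma flatEval_map {M N : QCoh p R} (f : M ⟶ N) (φ : (flat p R).obj M) (s : R) :
    flatEval (((flat p R).map f).hom φ) s = f.hom (flatEval φ s) := rfl

lemma flatEval_kappa {M : QCoh p R} (m : M) (s : R) :
    flatEval (((kappa p R).app M).hom m) s = (op (F p R) • op (coeff p R s) • m : M) := rfl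

lemma flatEval_coeff_smul {M : QCoh p R} (φ : (flat p R).obj M) (r s : R) :
    flatEval (op (coeff p R r) • φ) s = flatEval φ (s * r) :=
  congrArg (fun ψ : (flat p R).obj M ↦ flatEval ψ s)
    (ofStruct_coeff_smul _ (flatStruct M) r φ)

lemma F_smul_flat {M : QCoh p R} (φ : (flat p R).obj M) :
    op (F p R) • φ = ((kappa p R).app M).hom (flatEval φ 1) :=
  ofStruct_F_smul _ (flatStruct M) φ

lemma F_smul_coeff_smul_flat {M : QCoh p R} (φ : (flat p R).obj M) (s : R) :
    op (F p R) • op (coeff p R s) • φ = ((kappa p R).app M).hom (flatEval φ s) := by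
  rw [F_smul_flat, flatEval_coeff_smul, one_mul]

/-- Both maps send `φ` to `s ↦ κ_M(φ(s))`, by the formula for the action of `F` on `F^♭ M`. -/
lemma flat_map_kappa (M : QCoh p R) :
    (flat p R).map ((kappa p R).app M) = (kappa p R).app ((flat p R).obj M) := by
  ext φ
  refine flatEval_ext fun s ↦ ?_
  rw [flatEval_map, flatEval_kappa, F_smul_coeff_smul_flat]
  rfl

/-- Kernel and cokernel are killed by `F` itself, so the exponent is 1. -/
lemma isoModSerre_kappa [FFinite p R] (M : QCoh p R) :
    (LNil p R).isoModSerre ((kappa p R).app M) := by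
  rw [isoModSerre_LNil_iff]
  refine ⟨fun m hm ↦ ⟨1, fun r ↦ ?_⟩, fun φ ↦ ⟨1, fun r ↦ ⟨flatEval φ r, ?_⟩⟩⟩
  · rw [pow_one]
    exact congrArg (fun φ ↦ flatEval φ r) hm
  · rw [pow_one, F_smul_coeff_smul_flat]

/-- A directed system `X₀ ⟶ X₁ ⟶ ⋯` in which `X_e ⟶ X_{e + 1}` is the adjoint structural map
of `X_e`, up to isomorphism. -/
def IsKappaSystem (X : ℕ ⥤ QCoh p R) : Prop :=
  ∀ e, ∃ a : X.obj (e + 1) ≅ (flat p R).obj (X.obj e),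
    X.map (homOfLE e.le_succ) ≫ a.hom = (kappa p R).app (X.obj e)

/-- The recursion for `flatPow` applies the new `F^♭` first, whereas `κ` of the stage `F^{e♭} M`
needs it applied last. Induction with `M` replaced by `F^♭ M` reconciles the two, using
`flat_map_kappa`. -/
lemma exists_iso_flatPow (e : ℕ) (M : QCoh p R) :
    ∃ a : (flatPow p R (e + 1)).obj M ≅ (flat p R).obj ((flatPow p R e).obj M),
      (flatPowKappa p R e).app M ≫ a.hom = (kappa p R).app ((flatPow p R e).obj M) := by
  induction e generalizing M with
  | zero =>
    refine ⟨Iso.refl _, ?_⟩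
    exact (Category.comp_id _).trans (Category.id_comp _)
  | succ e ih =>
    obtain ⟨a, ha⟩ := ih ((flat p R).obj M)
    refine ⟨a, ?_⟩
    have : (flatPowKappa p R (e + 1)).app M = (flatPowKappa p R e).app ((flat p R).obj M) := by
      refine (Category.id_comp _).trans (Eq.trans ?_ (Category.id_comp _).symm)
      exact congrArg (flatPow p R e).map (flat_map_kappa M)
    rw [this]
    exact ha

lemma isKappaSystem_unitalizationSystem (M : QCoh p R) :
    IsKappaSystem ((unitalizationSystem p R).flip.obj M) := fun e ↦ by
  obtain ⟨a, ha⟩ := exists_iso_flatPow e M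
  exact ⟨a, (congrArg (fun f ↦ NatTrans.app f M ≫ a.hom)
    (Functor.ofSequence_map_homOfLE_succ (flatPowKappa p R) e)).trans ha⟩

lemma IsKappaSystem.isoModSerre_map [FFinite p R] {X : ℕ ⥤ QCoh p R} (hX : IsKappaSystem X)
    (e : ℕ) : (LNil p R).isoModSerre (X.map (homOfLE (Nat.zero_le e))) := by
  induction e with
  | zero =>
    have : X.map (homOfLE (Nat.zero_le 0)) = 𝟙 _ := X.map_id 0
    rw [this]
    exact MorphismProperty.id_mem _ _
  | succ e ih =>
    obtain ⟨a, ha⟩ := hX e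
    have h1 : (LNil p R).isoModSerre (X.map (homOfLE e.le_succ)) := by
      rw [← (LNil p R).isoModSerre.cancel_right_of_respectsIso _ a.hom, ha]
      exact isoModSerre_kappa _
    rw [← homOfLE_comp (Nat.zero_le e) e.le_succ, X.map_comp]
    exact MorphismProperty.comp_mem _ _ _ ih h1

variable {X : ℕ ⥤ QCoh p R} {c : Cocone X}

instance preservesColimit_forget_QCoh : PreservesColimit X (forget (QCoh p R)) :=
  have := preservesFilteredColimitsOfSize_shrink.{0, u, 0, u} (forget (QCoh p R))
  inferInstance

lemma exists_rep (hc : IsColimit c) (x : c.pt) : ∃ e, ∃ y : X.obj e, (c.ι.app e).hom y = x :=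
  Concrete.isColimit_exists_rep X hc x

lemma exists_map_eq_zero (hc : IsColimit c) {e : ℕ} {y : X.obj e} (h : (c.ι.app e).hom y = 0) :
    ∃ k, ∃ hk : e ≤ k, (X.map (homOfLE hk)).hom y = 0 := by
  obtain ⟨k, f, g, hfg⟩ := Concrete.isColimit_exists_of_rep_eq X hc y (0 : X.obj e)
    (h.trans (map_zero (c.ι.app e).hom).symm)
  exact ⟨k, leOfHom f, hfg.trans (map_zero (X.map g).hom)⟩

lemma ι_map_apply {i j : ℕ} (h : i ≤ j) (y : X.obj i) :
    (c.ι.app j).hom ((X.map (homOfLE h)).hom y) = (c.ι.app i).hom y :=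
  congrArg (fun f ↦ f.hom y) (c.w (homOfLE h))

lemma map_map_apply {i j k : ℕ} (h : i ≤ j) (h' : j ≤ k) (y : X.obj i) :
    (X.map (homOfLE h')).hom ((X.map (homOfLE h)).hom y) =
      (X.map (homOfLE (h.trans h'))).hom y :=
  congrArg (fun f ↦ f.hom y) (X.map_comp (homOfLE h) (homOfLE h')).symm

lemma IsKappaSystem.isoModSerre_ι [FFinite p R] (hX : IsKappaSystem X) (hc : IsColimit c) :
    (LNil p R).isoModSerre (c.ι.app 0) := by
  rw [isoModSerre_LNil_iff]
  constructor
  · intro a ha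
    obtain ⟨k, hk, h⟩ := exists_map_eq_zero hc ha
    exact ((isoModSerre_LNil_iff _).1 (hX.isoModSerre_map k)).1 a h
  · intro b
    obtain ⟨k, y, rfl⟩ := exists_rep hc b
    obtain ⟨n, hn⟩ := ((isoModSerre_LNil_iff _).1 (hX.isoModSerre_map k)).2 y
    refine ⟨n, fun r ↦ ?_⟩
    obtain ⟨a, ha⟩ := hn r
    exact ⟨a, by rw [← map_smul, ← map_smul, ← ha, ι_map_apply]⟩

lemma exists_map_eq_zero_of_finset {ι : Type*} (hc : IsColimit c) (T : Finset ι) {e : ℕ}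
    (y : ι → X.obj e) (h : ∀ t ∈ T, (c.ι.app e).hom (y t) = 0) :
    ∃ k, ∃ hk : e ≤ k, ∀ t ∈ T, (X.map (homOfLE hk)).hom (y t) = 0 := by
  classical
  have H (t : T) := exists_map_eq_zero hc (h t t.2)
  choose k hk hk' using H
  refine ⟨e + Finset.univ.sup k, by omega, fun t ht ↦ ?_⟩
  have hle : k ⟨t, ht⟩ ≤ e + Finset.univ.sup k :=
    (Finset.le_sup (f := k) (Finset.mem_univ _)).trans (by omega)
  rw [← map_map_apply (hk ⟨t, ht⟩) hle, hk', map_zero]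

lemma exists_eq_of_finite {ι : Type*} [Finite ι] (hc : IsColimit c) (x : ι → c.pt) :
    ∃ e, ∃ y : ι → X.obj e, ∀ t, (c.ι.app e).hom (y t) = x t := by
  have := Fintype.ofFinite ι
  choose e y hy using fun t ↦ exists_rep hc (x t)
  exact ⟨Finset.univ.sup e, fun t ↦ (X.map (homOfLE (Finset.le_sup (Finset.mem_univ t)))).hom (y t),
    fun t ↦ by rw [ι_map_apply, hy]⟩

/-- A linear map from a finitely presented module to the colimit comes from a finite stage. -/
lemma exists_lift_of_finitePresentation (hc : IsColimit c) {P : Type*} [AddCommGroup P]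
    [Module R P] [Module.FinitePresentation R P] (φ : P →ₗ[R] (underlying p R).obj c.pt) :
    ∃ e, ∃ ψ : P →ₗ[R] (underlying p R).obj (X.obj e),
      ((underlying p R).map (c.ι.app e)).hom ∘ₗ ψ = φ := by
  classical
  obtain ⟨n, K, q, T, hT⟩ := Module.FinitePresentation.exists_fin R P
  let φ' : (Fin n → R) →ₗ[R] (underlying p R).obj c.pt := φ ∘ₗ q.symm.toLinearMap ∘ₗ K.mkQ
  obtain ⟨e, y, hy⟩ := exists_eq_of_finite hc fun i : Fin n ↦ φ' (Pi.basisFun R (Fin n) i)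
  let ψ' : (Fin n → R) →ₗ[R] (underlying p R).obj (X.obj e) :=
    (Pi.basisFun R (Fin n)).constr R (fun i ↦ (y i : (underlying p R).obj (X.obj e)))
  have hψ' : ((underlying p R).map (c.ι.app e)).hom ∘ₗ ψ' = φ' := by
    refine (Pi.basisFun R (Fin n)).ext fun i ↦ ?_
    exact (congrArg ((underlying p R).map (c.ι.app e)).hom ((Pi.basisFun R (Fin n)).constr_basis R
      (M' := (underlying p R).obj (X.obj e)) y i)).trans (hy i)
  -- The lift on generators respects the relations only in the colimit; being finitely many, they
  -- all hold at a later stage `k`.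
  obtain ⟨k, hk, h⟩ := exists_map_eq_zero_of_finset hc T (fun t ↦ (ψ' t : X.obj e)) fun t ht ↦ by
    have h1 : ((underlying p R).map (c.ι.app e)).hom (ψ' t) = φ' t := LinearMap.congr_fun hψ' t
    have h2 : K.mkQ t = 0 := by
      rw [Submodule.mkQ_apply, Submodule.Quotient.mk_eq_zero, ← hT]
      exact Submodule.subset_span ht
    refine h1.trans ?_
    simp only [φ', LinearMap.comp_apply, h2, map_zero]
    rfl
  let ψ'' : (Fin n → R) →ₗ[R] (underlying p R).obj (X.obj k) :=
    ((underlying p R).map (X.map (homOfLE hk))).hom ∘ₗ ψ'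
  have hK : K ≤ LinearMap.ker ψ'' := by
    rw [← hT, Submodule.span_le]
    exact h
  refine ⟨k, K.liftQ ψ'' hK ∘ₗ q.toLinearMap, LinearMap.ext fun x ↦ ?_⟩
  obtain ⟨v, hv⟩ := K.mkQ_surjective (q x)
  have hx : x = q.symm (K.mkQ v) := by rw [hv, q.symm_apply_apply]
  have h3 : (K.liftQ ψ'' hK ∘ₗ q.toLinearMap) x = ψ'' v := by
    rw [LinearMap.comp_apply, LinearEquiv.coe_coe, ← hv]
    rfl
  rw [LinearMap.comp_apply, h3, hx]
  exact (ι_map_apply hk _).trans (LinearMap.congr_fun hψ' v)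

/-- Injectivity: the vanishing of `y r F` for all `r` follows from finitely many `r`, so it holds at
a finite stage, where the next transition map is `κ`. Surjectivity: a map from `F_* R` to the
colimit factors through some `X_k`, hence is an element of `F^♭ X_k ≅ X_(k+1)`. -/
theorem IsKappaSystem.kappaBijective [FFinite p R] [IsNoetherianRing R] (hX : IsKappaSystem X)
    (hc : IsColimit c) : KappaBijective c.pt where
  eq_zero n hn := by
    obtain ⟨e, y, rfl⟩ := exists_rep hc n
    obtain ⟨T, hT⟩ := exists_generators (FFinite.finite_frob (p := p) (R := R))
    obtain ⟨k, hk, h⟩ := exists_map_eq_zero_of_finset hc T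
      (fun t ↦ op (F p R) • op (coeff p R t) • y) fun t _ ↦ by
        rw [map_smul, map_smul]
        exact hn t
    have hκ (r : R) : op (F p R) • op (coeff p R r) • (X.map (homOfLE hk)).hom y = 0 := by
      refine hT (fun r ↦ op (F p R) • op (coeff p R r) • (X.map (homOfLE hk)).hom y = 0)
        (fun t ht ↦ ?_) (by simp) (fun r s hr hs ↦ ?_) (fun s r hr ↦ ?_) r
      · rw [← map_smul, ← map_smul]
        exact h t ht
      · rw [map_add, MulOpposite.op_add, add_smul, smul_add, hr, hs, add_zero]
      · rw [mul_comm, op_coeff_mul_smul, op_F_smul_op_coeff_smul, hr, smul_zero]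
    obtain ⟨a, ha⟩ := hX k
    have h0 : ((kappa p R).app (X.obj k)).hom ((X.map (homOfLE hk)).hom y) = 0 :=
      flatEval_ext hκ
    rw [← ha] at h0
    have h1 : (X.map (homOfLE k.le_succ)).hom ((X.map (homOfLE hk)).hom y) = 0 :=
      (ModuleCat.mono_iff_injective a.hom).1 inferInstance (h0.trans (map_zero a.hom.hom).symm)
    rw [← ι_map_apply hk, ← ι_map_apply k.le_succ, h1, map_zero]
  exists_eq φ hφ := by
    let P := (ModuleCat.restrictScalars (frob p R)).obj (ModuleCat.of R R)
    have : Module.Finite R P := FFinite.finite_frob (p := p) (R := R)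
    have : Module.FinitePresentation R P := Module.finitePresentation_of_finite R P
    let φ' : P →ₗ[R] (underlying p R).obj c.pt :=
      { toFun := fun r ↦ (φ r : c.pt)
        map_add' := fun r s ↦ φ.map_add r s
        map_smul' := fun s r ↦ hφ s r }
    obtain ⟨k, ψ, hψ⟩ := exists_lift_of_finitePresentation hc φ'
    have hψφ (r : R) : (c.ι.app k).hom (flatEval (M := X.obj k) ψ r) = φ r :=
      LinearMap.congr_fun hψ (r : P)
    obtain ⟨a, ha⟩ := hX k
    let x : X.obj (k + 1) := a.inv.hom (show (flat p R).obj (X.obj k) from ψ)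
    refine ⟨(c.ι.app (k + 1)).hom x, fun r ↦ ?_⟩
    have hx : op (F p R) • op (coeff p R r) • x =
        (X.map (homOfLE k.le_succ)).hom (flatEval (M := X.obj k) ψ r) := by
      refine (ModuleCat.mono_iff_injective a.hom).1 inferInstance ?_
      refine Eq.trans ?_ (congrArg (fun f ↦ f.hom (flatEval (M := X.obj k) ψ r)) ha.symm)
      refine Eq.trans ?_ (F_smul_coeff_smul_flat _ _)
      refine (map_smul a.hom.hom _ _).trans (congrArg _ ((map_smul a.hom.hom _ _).trans
        (congrArg _ ?_)))
      exact congrArg (fun f ↦ f.hom (show (flat p R).obj (X.obj k) from ψ)) a.inv_hom_id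
    rw [← map_smul, ← map_smul, hx, ι_map_apply, hψφ]

end Flat

/-! ### Localization via local replacements. -/

section LocalReplacement

variable {C : Type*} [Category* C] (W : MorphismProperty C)

/-- If every object has a morphism in `W` to a `W`-local object, then the localization functor with
respect to `W` has a fully faithful right adjoint. -/
theorem exists_rightAdjoint_of_local_replacement
    (h : ∀ X : C, ∃ (Y : C) (f : X ⟶ Y), W f ∧ W.isLocal Y) :
    ∃ G : W.Localization ⥤ C, Nonempty (W.Q ⊣ G) ∧ G.Full ∧ G.Faithful := by
  choose Y f hf hY using h
  have hle : W ≤ W.isLocal.isLocal := W.le_isLocal_isLocal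
  -- Precomposition with `f X` is bijective on maps to local objects, so `X ↦ Y X` is a reflection
  -- with unit `f`. The reflector is then itself a localization at `W`.
  let e (X : C) (Z : W.isLocal.FullSubcategory) :
      ((⟨Y X, hY X⟩ : W.isLocal.FullSubcategory) ⟶ Z) ≃ (X ⟶ W.isLocal.ι.obj Z) :=
    (ObjectProperty.fullyFaithfulι _).homEquiv.trans
      (Equiv.ofBijective _ (hle _ (hf X) Z.obj Z.property))
  have he (X Z Z' g k) : e X Z' (k ≫ g) = e X Z k ≫ W.isLocal.ι.map g :=
    (Category.assoc (f X) k.hom g.hom).symm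
  let adj := Adjunction.adjunctionOfEquivLeft e he
  have hunit (X : C) : adj.unit.app X = f X := by
    have h1 : adj.unit.app X = e X _ (𝟙 _) := by
      simp [adj]
    exact h1.trans (Category.comp_id _)
  have hinv : W.IsInvertedBy (Adjunction.leftAdjointOfEquiv e he) := fun A B s hs ↦ by
    have : IsIso (W.isLocal.ι.map ((Adjunction.leftAdjointOfEquiv e he).map s)) := by
      refine (W.isLocal.isLocal_iff_isIso _ (hY A) (hY B)).1 ?_
      have hnat : s ≫ f B =
          f A ≫ W.isLocal.ι.map ((Adjunction.leftAdjointOfEquiv e he).map s) := by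
        rw [← hunit, ← hunit]
        exact adj.unit.naturality s
      refine W.isLocal.isLocal.of_precomp (f A) _ (hle _ (hf A)) ?_
      rw [← hnat]
      exact W.isLocal.isLocal.comp_mem _ _ (hle _ hs) (hle _ (hf B))
    exact isIso_of_reflects_iso _ W.isLocal.ι
  have : (Adjunction.leftAdjointOfEquiv e he).IsLocalization W :=
    adj.isLocalization_leftAdjoint W hinv fun X ↦ by
      rw [hunit]
      exact hf X
  let E := Localization.equivalenceFromModel (Adjunction.leftAdjointOfEquiv e he) W
  refine ⟨E.functor ⋙ W.isLocal.ι, ⟨(adj.comp E.symm.toAdjunction).ofNatIsoLeft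
    (Localization.compEquivalenceFromModelInverseIso _ W)⟩, inferInstance, inferInstance⟩

variable {W}

/-- Every object in the image of a right adjoint of the localization functor is local. -/
lemma isLocal_rightAdjoint_obj {G : W.Localization ⥤ C} (adj : W.Q ⊣ G) (Z : W.Localization) :
    W.isLocal (G.obj Z) := fun A B s hs ↦ by
  have : IsIso (W.Q.map s) := Localization.inverts W.Q W s hs
  have hcomp : (fun g : B ⟶ G.obj Z ↦ s ≫ g) = adj.homEquiv A Z ∘ (fun g ↦ W.Q.map s ≫ g) ∘
      (adj.homEquiv B Z).symm := by
    funext g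
    simp [Adjunction.homEquiv_naturality_left]
  rw [hcomp]
  refine (adj.homEquiv A Z).bijective.comp (Function.Bijective.comp ⟨fun a b hab ↦ ?_, fun a ↦ ?_⟩
    (adj.homEquiv B Z).symm.bijective)
  · exact (cancel_epi (W.Q.map s)).1 hab
  · exact ⟨inv (W.Q.map s) ≫ a, by simp⟩

end LocalReplacement

/-! ### Comparison of `u` with `ubar ∘ π`, and exactness of `ubar`. -/

section Unitalization

variable {p : ℕ} [Fact p.Prime] {R : Type u} [CommRing R] [Algebra (ZMod p) R]

/-- `u(M)` is the colimit of `M ⟶ F^♭ M ⟶ F^{2♭} M ⟶ ⋯`. -/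
noncomputable def isColimitUnitalization (M : QCoh p R) :
    IsColimit (((evaluation _ _).obj M).mapCocone (colimit.cocone (unitalizationSystem p R))) :=
  isColimitOfPreserves _ (colimit.isColimit _)

lemma isoModSerre_eta [FFinite p R] (M : QCoh p R) :
    (LNil p R).isoModSerre ((eta p R).app M) :=
  IsKappaSystem.isoModSerre_ι (X := unitalizationSystem p R ⋙ (evaluation _ _).obj M)
    (isKappaSystem_unitalizationSystem M) (isColimitUnitalization M)

theorem isLocal_unitalization [FFinite p R] [IsNoetherianRing R] (M : QCoh p R) :
    (LNil p R).isoModSerre.isLocal ((unitalization p R).obj M) :=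
  (IsKappaSystem.kappaBijective (X := unitalizationSystem p R ⋙ (evaluation _ _).obj M)
    (isKappaSystem_unitalizationSystem M) (isColimitUnitalization M)).isLocal

/-- Over a noetherian ring the finite flat module `F_* R` is projective, so maps out of it lift
along surjections. -/
instance preservesEpimorphisms_flat [FFinite p R] [IsRegularRing R] :
    (flat p R).PreservesEpimorphisms where
  preserves {M N} f _ := by
    let P := (ModuleCat.restrictScalars (frob p R)).obj (ModuleCat.of R R)
    have : Module.Finite R P := FFinite.finite_frob (p := p) (R := R)
    have : Module.Flat R P := frob_flat_of_isRegularRing p R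
    have : Module.FinitePresentation R P := Module.finitePresentation_of_finite R P
    have : Module.Projective R P := Module.Flat.projective_of_finitePresentation
    refine (ModuleCat.epi_iff_surjective _).2 fun φ ↦ ?_
    obtain ⟨ψ, hψ⟩ := Module.projective_lifting_property (P := P)
      ((underlying p R).map f).hom (show P →ₗ[R] (underlying p R).obj N from φ)
      ((ModuleCat.epi_iff_surjective f).1 inferInstance)
    exact ⟨ψ, hψ⟩

instance preservesEpimorphisms_flatPow [FFinite p R] [IsRegularRing R] (e : ℕ) :
    (flatPow p R e).PreservesEpimorphisms := by
  induction e with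
  | zero => exact inferInstanceAs (𝟭 (QCoh p R)).PreservesEpimorphisms
  | succ e ih => exact inferInstanceAs (flat p R ⋙ flatPow p R e).PreservesEpimorphisms

instance preservesEpimorphisms_unitalization [FFinite p R] [IsRegularRing R] :
    (unitalization p R).PreservesEpimorphisms where
  preserves {M N} f _ := ⟨fun g h hgh ↦ by
    refine (isColimitUnitalization N).hom_ext fun e ↦ ?_
    have hnat : (flatPow p R e).map f ≫ (colimit.ι (unitalizationSystem p R) e).app N =
        (colimit.ι (unitalizationSystem p R) e).app M ≫ (unitalization p R).map f :=
      (colimit.ι (unitalizationSystem p R) e).naturality f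
    refine (cancel_epi ((flatPow p R e).map f)).1 ?_
    exact (Category.assoc _ _ _).symm.trans ((congrArg (· ≫ g) hnat).trans
      ((Category.assoc _ _ _).trans ((congrArg _ hgh).trans ((Category.assoc _ _ _).symm.trans
        ((congrArg (· ≫ h) hnat).symm.trans (Category.assoc _ _ _))))))⟩

variable [FFinite p R]

lemma isIso_toCrys_map_iff {M N : QCoh p R} (f : M ⟶ N) :
    IsIso ((toCrys p R).map f) ↔ (LNil p R).isoModSerre f :=
  ObjectProperty.SerreClassLocalization.isIso_map_iff (toCrys p R) (LNil p R) f

lemma preservesFiniteLimits_toCrys : PreservesFiniteLimits (toCrys p R) :=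
  ObjectProperty.SerreClassLocalization.preservesFiniteLimits (toCrys p R) (LNil p R)

lemma preservesFiniteColimits_toCrys : PreservesFiniteColimits (toCrys p R) :=
  ObjectProperty.SerreClassLocalization.preservesFiniteColimits (toCrys p R) (LNil p R)

variable {ubar : QCrys p R ⥤ QCoh p R} (adj : toCrys p R ⊣ ubar)
include adj

/-- By the triangle identity `π` inverts the unit, so the unit is a nil-isomorphism; between local
objects it is an isomorphism. -/
lemma isIso_unit_app_of_isLocal [IsIso adj.counit] {N : QCoh p R}
    (hN : (LNil p R).isoModSerre.isLocal N) : IsIso (adj.unit.app N) := by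
  have hW : (LNil p R).isoModSerre (adj.unit.app N) := by
    rw [← isIso_toCrys_map_iff]
    exact (IsIso.of_isIso_fac_right (adj.left_triangle_components N) :)
  exact (ObjectProperty.isLocal_iff_isIso _ _ hN (isLocal_rightAdjoint_obj adj _)).1
    ((LNil p R).isoModSerre.le_isLocal_isLocal _ hW)

/-- The unitalization is the monad of the adjunction between Cartier modules and crystals. -/
lemma exists_unitalization_iso [IsNoetherianRing R] [IsIso adj.counit] :
    ∃ e : unitalization p R ≅ toCrys p R ⋙ ubar, eta p R ≫ e.hom = adj.unit := by
  -- The comparison is `u(M) ⟶ ubar π u(M) ⟵ ubar π M`: the unit at the local object `u(M)`, and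
  -- `ubar π` of the nil-isomorphism `η`.
  have h1 : IsIso (Functor.whiskerLeft (unitalization p R) adj.unit) := by
    rw [NatTrans.isIso_iff_isIso_app]
    exact fun M ↦ isIso_unit_app_of_isLocal adj (isLocal_unitalization M)
  have h2 : IsIso (Functor.whiskerRight (eta p R) (toCrys p R ⋙ ubar)) := by
    rw [NatTrans.isIso_iff_isIso_app]
    intro M
    have : IsIso ((toCrys p R).map ((eta p R).app M)) :=
      (isIso_toCrys_map_iff _).2 (isoModSerre_eta M)
    exact inferInstanceAs (IsIso (ubar.map ((toCrys p R).map ((eta p R).app M))))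
  refine ⟨asIso (Functor.whiskerLeft (unitalization p R) adj.unit) ≪≫
    (asIso (Functor.whiskerRight (eta p R) (toCrys p R ⋙ ubar))).symm, ?_⟩
  have hnat : eta p R ≫ Functor.whiskerLeft (unitalization p R) adj.unit =
      adj.unit ≫ Functor.whiskerRight (eta p R) (toCrys p R ⋙ ubar) := by
    ext1
    ext1 M
    exact adj.unit.naturality ((eta p R).app M)
  rw [Iso.trans_hom, Iso.symm_hom, ← Category.assoc, Iso.comp_inv_eq]
  exact hnat

/-- For an epimorphism `g`, the inclusion of the image of `ubar g` becomes an isomorphism under `π`.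
Since `ubar ∘ π ≅ u` preserves the epimorphism onto that image, `ubar π (ubar g)` is an epimorphism,
and the units at the local objects `ubar Y` and `ubar Z` identify it with `ubar g`. -/
lemma preservesEpimorphisms_rightAdjoint [IsRegularRing R] [IsIso adj.counit] :
    ubar.PreservesEpimorphisms where
  preserves {Y Z} g _ := by
    obtain ⟨e, -⟩ := exists_unitalization_iso adj
    have hU : (toCrys p R ⋙ ubar).PreservesEpimorphisms := .of_iso e
    have := preservesFiniteLimits_toCrys (p := p) (R := R)
    have hm : Mono ((toCrys p R).map (image.ι (ubar.map g))) := inferInstance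
    have hg : (toCrys p R).map (ubar.map g) ≫ adj.counit.app Z = adj.counit.app Y ≫ g :=
      adj.counit.naturality g
    have hg' : Epi ((toCrys p R).map (ubar.map g)) := by
      rw [← IsIso.eq_comp_inv] at hg
      rw [hg]
      infer_instance
    have hfac : (toCrys p R).map (factorThruImage (ubar.map g)) ≫
        (toCrys p R).map (image.ι (ubar.map g)) = (toCrys p R).map (ubar.map g) := by
      rw [← Functor.map_comp, image.fac]
    have he : Epi ((toCrys p R).map (image.ι (ubar.map g))) := by
      rw [← hfac] at hg'
      exact epi_of_epi ((toCrys p R).map (factorThruImage (ubar.map g))) _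
    have hi : IsIso ((toCrys p R).map (image.ι (ubar.map g))) := isIso_of_mono_of_epi _
    have h1 : Epi ((toCrys p R ⋙ ubar).map (factorThruImage (ubar.map g))) := inferInstance
    have h2 : Epi (ubar.map ((toCrys p R).map (ubar.map g))) := by
      rw [← hfac, ubar.map_comp]
      have : Epi (ubar.map ((toCrys p R).map (factorThruImage (ubar.map g)))) := h1
      infer_instance
    have hY : IsIso (adj.unit.app (ubar.obj Y)) :=
      isIso_unit_app_of_isLocal adj (isLocal_rightAdjoint_obj adj Y)
    have hZ : IsIso (adj.unit.app (ubar.obj Z)) :=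
      isIso_unit_app_of_isLocal adj (isLocal_rightAdjoint_obj adj Z)
    have hn : ubar.map g ≫ adj.unit.app (ubar.obj Z) =
        adj.unit.app (ubar.obj Y) ≫ ubar.map ((toCrys p R).map (ubar.map g)) :=
      adj.unit.naturality (ubar.map g)
    rw [← IsIso.eq_comp_inv] at hn
    rw [hn]
    have hYe : Epi (adj.unit.app (ubar.obj Y)) := IsIso.epi_of_iso _
    exact epi_comp' (epi_comp' hYe h2) (IsIso.epi_of_iso _)

lemma preservesFiniteLimits_rightAdjoint : PreservesFiniteLimits ubar :=
  have : PreservesLimitsOfSize.{0, 0} ubar := adj.rightAdjoint_preservesLimits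
  inferInstance

lemma preservesFiniteColimits_rightAdjoint [IsRegularRing R] [IsIso adj.counit] :
    PreservesFiniteColimits ubar := by
  have := preservesFiniteLimits_rightAdjoint adj
  have := preservesEpimorphisms_rightAdjoint adj
  have : ubar.Additive := adj.right_adjoint_additive
  rw [ubar.preservesFiniteColimits_iff_forall_exact_map_and_epi]
  intro S hS
  have := hS.epi_g
  exact ⟨(ubar.preservesFiniteLimits_iff_forall_exact_map_and_mono.1 inferInstance S hS).1,
    inferInstance⟩

end Unitalization

end Cartier

theorem mainTheorem8 (p : ℕ) [Fact p.Prime] (R : Type u) [CommRing R] [Algebra (ZMod p) R]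
    [IsNoetherianRing R] [Cartier.FFinite p R] :
    -- `π` is exact
    (PreservesFiniteLimits (Cartier.toCrys p R) ∧ PreservesFiniteColimits (Cartier.toCrys p R)) ∧
    -- `π` has a right adjoint
    (∃ ubar : Cartier.QCrys p R ⥤ Cartier.QCoh p R, Nonempty (Cartier.toCrys p R ⊣ ubar)) ∧
    ∀ (ubar : Cartier.QCrys p R ⥤ Cartier.QCoh p R) (adj : Cartier.toCrys p R ⊣ ubar),
      -- `π ∘ ubar ⟶ id` is an isomorphism, equivalently `ubar` is fully faithful
      IsIso adj.counit ∧ ubar.Full ∧ ubar.Faithful ∧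
      -- `ubar` preserves injectives
      (∀ I : Cartier.QCrys p R, Injective I → Injective (ubar.obj I)) ∧
      (IsRegularRing R →
        -- `ubar` is exact
        (PreservesFiniteLimits ubar ∧ PreservesFiniteColimits ubar) ∧
        -- `u = ubar ∘ π`, compatibly with the maps from the identity
        (∃ e : Cartier.unitalization p R ≅ Cartier.toCrys p R ⋙ ubar,
          Cartier.eta p R ≫ e.hom = adj.unit) ∧
        -- `ubar` reflects injectivity
        ∀ I : Cartier.QCrys p R, Injective (ubar.obj I) → Injective I) := by
  have hlim := Cartier.preservesFiniteLimits_toCrys (p := p) (R := R)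
  obtain ⟨G, ⟨adjG⟩, hfull, hfaithful⟩ :=
    Cartier.exists_rightAdjoint_of_local_replacement (Cartier.LNil p R).isoModSerre
      fun M ↦ ⟨_, _, Cartier.isoModSerre_eta M, Cartier.isLocal_unitalization M⟩
  refine ⟨⟨hlim, Cartier.preservesFiniteColimits_toCrys⟩, ⟨G, ⟨adjG⟩⟩, fun ubar adj ↦ ?_⟩
  -- Right adjoints are unique up to isomorphism, so full faithfulness passes from the constructed
  -- `G` to an arbitrary `ubar`.
  have hfull : ubar.Full := .of_iso (adjG.rightAdjointUniq adj)
  have hfaithful : ubar.Faithful := .of_iso (adjG.rightAdjointUniq adj)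
  have hcounit : IsIso adj.counit := inferInstance
  refine ⟨hcounit, hfull, hfaithful, fun I hI ↦ adj.map_injective I hI, fun hR ↦
    ⟨⟨Cartier.preservesFiniteLimits_rightAdjoint adj,
      Cartier.preservesFiniteColimits_rightAdjoint adj⟩,
    Cartier.exists_unitalization_iso adj, fun I hI ↦ adj.injective_of_map_injective I hI⟩⟩
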